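/- **Setting.** Consider a radial network: a tree with root (slack node) $0$ and nodes $j\in\{1,\dots,J\}$; branch $j$ joins the upstream node $i=i(j)$ to $j$. Given are series resistances $r_j$ and reactances $x_j$, tap ratios $a_j\neq 0$, shunt parameters $G_j,B_j$ (all real), the squared slack voltage $v_0>0$, and injections $\bar w=(\bar p,\bar q)\in\mathbb R^{2J}$. For $x=(P,Q,l,v,p,q)\in\mathbb R^{6J}$ write $w=(p,q)$, and let $F(x)=0$ stand for the $4J$ branch flow equations, for all $j$, $$\sum_{j':\,i(j')=j}P_{j'}-P_j+a_j^2r_jl_j+G_jv_j=p_j,\qquad \sum_{j':\,i(j')=j}Q_{j'}-Q_j+a_j^2x_jl_j-B_jv_j=q_j,$$ $$v_j=\frac{v_i}{a_j^2}-2(r_jP_j+x_jQ_j)+a_j^2(r_j^2+x_j^2)l_j,\qquad v_il_j=P_j^2+Q_j^2 .$$ Let $\mathcal M$ be the set of $x$ with $F(x)=0$ whose sending-end voltages $v_{i(j)}$ are all nonzero, with tangent spaces $T_x\mathcal M=\ker DF(x)$ and the Euclidean metric, and let $f(x)=\|w-\bar w\|_2^2$. Put $\Pi_x=I-DF(x)^T(DF(x)DF(x)^T)^{-1}DF(x)$,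 $\operatorname{grad}f(x)=\Pi_x\nabla f(x)$ and $\operatorname{hess}f(x)[\xi]=\Pi_x\,D(\operatorname{grad}f)(x)[\xi]$ for $\xi\in T_x\mathcal M$. Let $C_x$ be the matrix with $n$-th column $(\partial\Pi_x/\partial x_n)\nabla f(x)$, and $E_x=-\Pi_xC_x$. The retraction $R_x(\xi)$ is the forward sweep started from $\tilde x=x+\xi$: keep $P=\tilde P$, $Q=\tilde Q$; from the root on set $l_j=(\tilde P_j^2+\tilde Q_j^2)/v_i$ and $v_j=v_i/a_j^2-2(r_j\tilde P_j+x_j\tilde Q_j)+a_j^2(r_j^2+x_j^2)l_j$; then compute $p,q$ from the power balances. It is defined if no division by zero occurs. A *direction* at $x\in\mathcal M$ is a solution $\xi=(\zeta,\eta)\in\mathbb R^{4J}\times\mathbb R^{2J}$ of the square linear system $\xi\in T_x\mathcal M$, $w+\eta=\bar w$; call $x$ *nondegenerate* if this system has linearly independent rows. With parameters $\bar\alpha>0$, $\beta,\sigma\in(0,1)$ and a tolerance $\varepsilon\ge 0$, the *method* starts at $x_0\in\mathcal M$ and, while $\|\operatorname{grad}f(x_k)\|>\varepsilon$, takes a direction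 $\xi_k$ at $x_k$ and sets $x_{k+1}=R_{x_k}(\alpha_k\xi_k)$, $\alpha_k=\beta^{m}\bar\alpha$, where $m\ge0$ is the least integer for which $R_{x_k}(\alpha_k\xi_k)$ is defined and $$f(x_k)-f\big(R_{x_k}(\alpha_k\xi_k)\big)\ \ge\ -\sigma\,\langle\operatorname{grad}f(x_k),\alpha_k\xi_k\rangle .$$ **Proposition.** 1. *(Riemannian approximate Newton method.)* For every $x\in\mathcal M$, $DF(x)$ is onto, and $R_x$ is a retraction at $x$: it is defined and smooth on an open neighbourhood of $0$ in $T_x\mathcal M$, has values in $\mathcal M$, $R_x(0)=x$, and $\frac{d}{dt}R_x(t\xi)|_{t=0}=\xi$ for $\xi \in T_x\mathcal M$. Every direction $\xi$ at $x$ satisfies $$\operatorname{hess}f(x)[\xi]+E_x\xi=-\operatorname{grad}f(x).$$ If $x$ is nondegenerate, there is exactly one direction at $x$, and this equation has exactly one solution in $T_x\mathcal M$. For every compact set $K$ of nondegenerate points of $\mathcal M$ there is a constant $\gamma$ with $\|E_x\|_2\le\gamma\,\|\operatorname{grad}f(x)\|_2$ for all $x\in K$. 2. *(Descent.)* If $x\in\mathcal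 M$, $\operatorname{grad}f(x)\ne0$ and $\xi$ is a direction at $x$, then $\langle\operatorname{grad}f(x),\xi\rangle<0$ and the Armijo search terminates. All iterates $x_k$ of the method lie in $\mathcal M$, and $f(x_{k+1})<f(x_k)$ at every iteration. 3. *(Accumulation points.)* If the method is run with $\varepsilon=0$, or never stops, then every nondegenerate accumulation point $x_*\in\mathcal M$ of $(x_k)$ is critical: $\operatorname{grad}f(x_*)=0$. (After stopping, the sequence is continued as a constant.) 4. *(Local superlinear convergence.)* Let $x_*\in\mathcal M$ be a nondegenerate critical point of $f$. Then $x_*$ has a neighbourhood $U$ such that for every $x_0\in U$ with $F(x_0)=0$ the iteration $x_{k+1}=R_{x_k}(\xi_k)$ with unit steps can be carried out for all $k$, and every sequence so obtained converges to $x_*$ with $\|x_{k+1}-x_*\|=o(\|x_k-x_*\|)$. If $\bar\alpha=1$ and $\sigma<\tfrac12$, then, for some such neighbourhood, the same holds for the method with its Armijo step sizes and $\varepsilon=0$. -/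

import Mathlib

open Filter Topology Set
open scoped ContDiff

noncomputable section

/-! ## Submanifolds of Euclidean space given by equations `h x = 0` -/

section Riemannian

variable {E V : Type*} [NormedAddCommGroup E] [InnerProductSpace ℝ E] [CompleteSpace E]
  [NormedAddCommGroup V] [InnerProductSpace ℝ V] [CompleteSpace V]

/-- Tangent space at `x` of `{x | h x = 0}`: the kernel of the differential of `h`. -/
def tangentAt (h : E → V) (x : E) : Submodule ℝ E := (fderiv ℝ h x).ker

/-- The projection `Π_x = I - Dhᵀ (Dh Dhᵀ)⁻¹ Dh`, i.e. the orthogonal projection onto the tangent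
space at every point `x` where `Dh(x)` has full row rank. -/
def tangentProj (h : E → V) (x : E) : E →L[ℝ] E :=
  ContinuousLinearMap.id ℝ E -
    (ContinuousLinearMap.adjoint (fderiv ℝ h x)) ∘L
      (((fderiv ℝ h x) ∘L (ContinuousLinearMap.adjoint (fderiv ℝ h x))).inverse ∘L (fderiv ℝ h x))

/-- Riemannian gradient: the projection of the Euclidean gradient. -/
def riemGrad (h : E → V) (f : E → ℝ) (x : E) : E := tangentProj h x (gradient f x)

/-- Riemannian Hessian `ξ ↦ Π_x D(grad f)(x)[ξ]`; only its values at tangent vectors are used. -/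
def riemHess (h : E → V) (f : E → ℝ) (x : E) : E →L[ℝ] E :=
  tangentProj h x ∘L fderiv ℝ (riemGrad h f) x

/-- The matrix `C_x`, with `n`-th column `(∂Π_x / ∂x_n) (Grad f (x))`. -/
def projDerivTerm (h : E → V) (f : E → ℝ) (x : E) : E →L[ℝ] E :=
  (fderiv ℝ (tangentProj h) x).flip (gradient f x)

/-- The Hessian error `E_x = - Π_x C_x`. -/
def hessError (h : E → V) (f : E → ℝ) (x : E) : E →L[ℝ] E :=
  -(tangentProj h x ∘L projDerivTerm h f x)

/-- `ξ` is a tangent vector at `x` that solves the approximate Newton equation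
`[hess f(x) + Err] ξ = - grad f(x)`. -/
def IsApproxNewtonDirection (h : E → V) (f : E → ℝ) (Err : E →L[ℝ] E) (x ξ : E) : Prop :=
  ξ ∈ tangentAt h x ∧ riemHess h f x ξ + Err ξ = -riemGrad h f x

/-- `R` is a retraction at `x` of `{x | h x = 0}`, defined at the tangent vectors that lie in
`D`, which form an open neighbourhood of the origin of the tangent space. -/
structure IsRetractionAt (h : E → V) (x : E) (D : Set E) (R : E → E) : Prop where
  isOpen_domain : IsOpen {ξ : tangentAt h x | (ξ : E) ∈ D}
  zero_mem : (0 : E) ∈ D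
  smooth : ContDiffOn ℝ ∞ (fun ξ : tangentAt h x => R ξ) {ξ : tangentAt h x | (ξ : E) ∈ D}
  maps_to : ∀ ξ ∈ tangentAt h x, ξ ∈ D → h (R ξ) = 0
  centering : R 0 = x
  local_rigidity : ∀ ξ ∈ tangentAt h x, HasDerivAt (fun t : ℝ => R (t • ξ)) ξ 0

/-- The sequence `x` converges to `xs` with a superlinear rate. -/
def ConvergesSuperlinearly (x : ℕ → E) (xs : E) : Prop :=
  Tendsto x atTop (𝓝 xs) ∧
    (fun k => ‖x (k + 1) - xs‖) =o[atTop] (fun k => ‖x k - xs‖)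

end Riemannian

/-! ## The branch flow model of a radial network -/

/-- A radial network with slack node `0` and further nodes (equivalently, branches) indexed by
`Fin J`. Branch `j` runs from the upstream node of `j` to `j`. -/
structure RadialNetwork (J : ℕ) where
  /-- the upstream node; `none` is the slack node -/
  parent : Fin J → Option (Fin J)
  /-- the graph is a tree rooted at the slack node: no node is its own ancestor -/
  parent_wf : WellFounded (fun i j : Fin J => parent j = some i)
  /-- series resistances -/
  res : Fin J → ℝ
  /-- series reactances -/
  react : Fin J → ℝ
  /-- transformer tap ratios -/
  tap : Fin J → ℝ
  tap_ne_zero : ∀ j, tap j ≠ 0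
  /-- shunt conductances `G` -/
  shuntG : Fin J → ℝ
  /-- shunt susceptances `B`, the shunt admittance being `G - iB` -/
  shuntB : Fin J → ℝ
  /-- squared voltage magnitude of the slack node -/
  slackV : ℝ
  slackV_pos : 0 < slackV

/-- The variables `x = (P, Q, l, v, p, q)` in `ℝ^{6J}` with the Euclidean norm: `x (c, j)` for
`c = 0, 1, 2, 3, 4, 5` is `P_j, Q_j, l_j, v_j, p_j, q_j`. -/
abbrev LFState (J : ℕ) : Type := EuclideanSpace ℝ (Fin 6 × Fin J)

/-- The injections `w = (p, q)` in `ℝ^{2J}`. -/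
abbrev Injections (J : ℕ) : Type := EuclideanSpace ℝ (Fin 2 × Fin J)

/-- The block `w = (p, q)` of `x`. -/
def injectionsOf {J : ℕ} (x : LFState J) : Injections J :=
  WithLp.toLp 2 fun cj => ![x (4, cj.2), x (5, cj.2)] cj.1

namespace RadialNetwork

variable {J : ℕ} (N : RadialNetwork J)

/-- Voltage of the upstream node of branch `j`, for given voltages of the non-slack nodes. -/
def upV (v : Fin J → ℝ) (j : Fin J) : ℝ :=
  match N.parent j with
  | none => N.slackV
  | some i => v i

/-- Real power injection at `j` determined by the power balance. -/
def realInj (P l v : Fin J → ℝ) (j : Fin J) : ℝ :=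
  (∑ j' with N.parent j' = some j, P j') - P j + N.tap j ^ 2 * N.res j * l j + N.shuntG j * v j

/-- Reactive power injection at `j` determined by the power balance. -/
def reactInj (Q l v : Fin J → ℝ) (j : Fin J) : ℝ :=
  (∑ j' with N.parent j' = some j, Q j') - Q j + N.tap j ^ 2 * N.react j * l j - N.shuntB j * v j

/-- Voltage of the downstream node of `j`, given the upstream voltage and the branch values. -/
def dropV (j : Fin J) (vi P Q l : ℝ) : ℝ :=
  vi / N.tap j ^ 2 - 2 * (N.res j * P + N.react j * Q)
    + N.tap j ^ 2 * (N.res j ^ 2 + N.react j ^ 2) * l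

/-- The branch flow equations in the form `F x = 0`: real and reactive power balance, voltage
drop, and the relation `v_i l_j = P_j ^ 2 + Q_j ^ 2`, for every branch `j`. -/
def F (x : LFState J) : EuclideanSpace ℝ (Fin 4 × Fin J) :=
  WithLp.toLp 2 fun cj =>
    ![N.realInj (fun i => x (0, i)) (fun i => x (2, i)) (fun i => x (3, i)) cj.2 - x (4, cj.2),
      N.reactInj (fun i => x (1, i)) (fun i => x (2, i)) (fun i => x (3, i)) cj.2 - x (5, cj.2),
      N.dropV cj.2 (N.upV (fun i => x (3, i)) cj.2) (x (0, cj.2)) (x (1, cj.2)) (x (2, cj.2))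
        - x (3, cj.2),
      N.upV (fun i => x (3, i)) cj.2 * x (2, cj.2) - (x (0, cj.2) ^ 2 + x (1, cj.2) ^ 2)] cj.1

/-- The BFM manifold `{x | F x = 0}`, at points where the voltages at the sending ends of the
branches do not vanish. -/
def manifold : Set (LFState J) :=
  {x | N.F x = 0 ∧ ∀ j, N.upV (fun i => x (3, i)) j ≠ 0}

/-- The mismatch `f(x) = ‖w - w̄‖ ^ 2`. -/
def cost (wbar : Injections J) (x : LFState J) : ℝ := ‖injectionsOf x - wbar‖ ^ 2

/-- Riemannian gradient of the mismatch. -/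
def grad (wbar : Injections J) (x : LFState J) : LFState J := riemGrad N.F (cost wbar) x

/-- `ξ = (ζ, η)` solves the linear system `ξ ∈ T_x`, `w + η = w̄`. -/
def IsDirection (wbar : Injections J) (x ξ : LFState J) : Prop :=
  ξ ∈ tangentAt N.F x ∧ injectionsOf x + injectionsOf ξ = wbar

/-- The (square) linear system for the direction has linearly independent rows, i.e. its
coefficient map `ξ ↦ (DF(x)[ξ], η)` is onto. -/
def RowsIndependent (x : LFState J) : Prop :=
  Function.Surjective fun ξ : LFState J => (fderiv ℝ N.F x ξ, injectionsOf ξ)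

/-! ### The forward sweep retraction -/

/-- Swept voltages: from the root on, `l_j = (P_j ^ 2 + Q_j ^ 2) / v_i`, followed by the voltage
drop equation, with `P`, `Q` taken from `y`. -/
def sweepV (y : LFState J) : Fin J → ℝ :=
  N.parent_wf.fix fun j v =>
    let vi : ℝ := match h : N.parent j with
      | none => N.slackV
      | some i => v i h
    N.dropV j vi (y (0, j)) (y (1, j)) ((y (0, j) ^ 2 + y (1, j) ^ 2) / vi)

theorem sweepV_eq (y : LFState J) (j : Fin J) :
    N.sweepV y j = N.dropV j (N.upV (N.sweepV y) j) (y (0, j)) (y (1, j))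
      ((y (0, j) ^ 2 + y (1, j) ^ 2) / N.upV (N.sweepV y) j) := by
  have key : (match h : N.parent j with
      | none => N.slackV
      | some i => (fun (i : Fin J) (_ : N.parent j = some i) => N.sweepV y i) i h)
      = N.upV (N.sweepV y) j := by
    unfold upV
    split <;> rename_i h <;> simp [h]
  rw [← key]
  conv_lhs => rw [sweepV, WellFounded.fix_eq]
  rfl

/-- Swept squared currents. -/
def sweepL (y : LFState J) (j : Fin J) : ℝ :=
  (y (0, j) ^ 2 + y (1, j) ^ 2) / N.upV (N.sweepV y) j

/-- The forward sweep: `P`, `Q` are kept, `l`, `v` are swept from the root, and `p`, `q` are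
obtained from the power balances. -/
def sweep (y : LFState J) : LFState J :=
  WithLp.toLp 2 fun cj =>
    ![y (0, cj.2), y (1, cj.2), N.sweepL y cj.2, N.sweepV y cj.2,
      N.realInj (fun i => y (0, i)) (N.sweepL y) (N.sweepV y) cj.2,
      N.reactInj (fun i => y (1, i)) (N.sweepL y) (N.sweepV y) cj.2] cj.1

/-- The vectors `ξ` for which the sweep started at `x + ξ` never divides by zero. -/
def retrDomain (x : LFState J) : Set (LFState J) :=
  {ξ | ∀ j, N.upV (N.sweepV (x + ξ)) j ≠ 0}

/-- The retraction `R_x(ξ)`. -/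
def retr (x ξ : LFState J) : LFState J := N.sweep (x + ξ)

/-! ### The algorithm -/

/-- The step size `α` passes the Armijo test at `x` along `ξ`; in particular `R_x(α ξ)` must be
defined. -/
def ArmijoTest (wbar : Injections J) (σ : ℝ) (x ξ : LFState J) (α : ℝ) : Prop :=
  α • ξ ∈ N.retrDomain x ∧
    cost wbar x - cost wbar (N.retr x (α • ξ)) ≥ -σ * inner ℝ (N.grad wbar x) (α • ξ)

/-- The sequences of points `x k`, directions `ξ k` and Armijo exponents `m k` generated by the
proposed method from `x 0`. As long as `‖grad f(x k)‖ > ε`, the step `β ^ (m k) * αbar` is taken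
along `ξ k`, where `m k` is the smallest exponent that passes the Armijo test; once
`‖grad f(x k)‖ ≤ ε`, the method has stopped and `x` stays put. -/
structure IsRun (wbar : Injections J) (αbar β σ ε : ℝ)
    (x ξ : ℕ → LFState J) (m : ℕ → ℕ) : Prop where
  init : x 0 ∈ N.manifold
  direction : ∀ k, ε < ‖N.grad wbar (x k)‖ → N.IsDirection wbar (x k) (ξ k)
  armijo : ∀ k, ε < ‖N.grad wbar (x k)‖ →
    IsLeast {n : ℕ | N.ArmijoTest wbar σ (x k) (ξ k) (β ^ n * αbar)} (m k)
  step : ∀ k, ε < ‖N.grad wbar (x k)‖ → x (k + 1) = N.retr (x k) ((β ^ m k * αbar) • ξ k)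
  halt : ∀ k, ‖N.grad wbar (x k)‖ ≤ ε → x (k + 1) = x k

/-- The sequence `x` is generated by the method with all step sizes equal to `1`. -/
def IsUnitStepRun (wbar : Injections J) (x : ℕ → LFState J) : Prop :=
  x 0 ∈ N.manifold ∧ ∀ k, ∃ ξ, N.IsDirection wbar (x k) ξ ∧ ξ ∈ N.retrDomain (x k) ∧
    x (k + 1) = N.retr (x k) ξ

end RadialNetwork

end

/-! Write `r = w - w̄` for the mismatch, so that `f = ‖r‖²`. A direction satisfies `η = -r`, and its
inner product with `grad f` is `2⟨r, η⟩ = -2 f(x)`; this identity gives descent and is used in every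
Armijo estimate. Differentiating `Π_x (2 πᵀ r)`, with `π x = w`, produces a derivative of `Π`, which
`E_x` cancels exactly. What remains is the Gauss-Newton operator `ξ ↦ Π_x (2 πᵀ π ξ)`, and a
direction solves its equation because it annihilates the linearized residual `r + π ξ`.

The tree makes the flow equations triangular: `P`, `Q` determine `l`, `v` from the root on, and then
`p`, `q`. Hence `DF` is onto by a dimension count, and the sweep, which fixes the manifold and keeps
`P`, `Q`, is tangent to the identity on tangent vectors.

At a nondegenerate point the system matrix `A(x)` is invertible, and `2‖r‖² = |⟨grad f, ξ⟩|` yields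
`‖r‖ ≤ ‖A(x)⁻¹‖ ‖grad f‖` (`norm_injections_sub_le`). This bounds `E_x`, which is linear in `r`, and
shows that nondegenerate critical points have zero mismatch.

Near a nondegenerate noncritical point the accepted steps are bounded below
(`eventually_armijoTest`), so each visit costs a fixed amount of `f`; this excludes such
accumulation points. Near a nondegenerate critical point, `x + ξ` is the Newton step for the square
system `F = 0`, `w = w̄`, and the sweep loses only a constant factor (`isLittleO_newtonPt`). -/

noncomputable section

/-! ### Tangent projections and the Gauss-Newton equation -/

section Projection

variable {E V W : Type*} [NormedAddCommGroup E] [InnerProductSpace ℝ E] [CompleteSpace E]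
  [NormedAddCommGroup V] [InnerProductSpace ℝ V] [CompleteSpace V]
  [NormedAddCommGroup W] [InnerProductSpace ℝ W] [CompleteSpace W]

open ContinuousLinearMap

/-- If `D Dᵀ v = 0` then `Dᵀ v = 0`, so `v` is orthogonal to the range of `D`, which is everything.
-/
theorem isInvertible_comp_adjoint [FiniteDimensional ℝ V] {D : E →L[ℝ] V}
    (hD : Function.Surjective D) : (D ∘L adjoint D).IsInvertible := by
  have hinj : Function.Injective (D ∘L adjoint D) := by
    rw [injective_iff_map_eq_zero]
    intro v hv
    obtain ⟨y, rfl⟩ := hD v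
    have h1 : inner ℝ (adjoint D (D y)) (adjoint D (D y)) = 0 := by
      rw [adjoint_inner_left]
      have : D (adjoint D (D y)) = 0 := hv
      rw [this, inner_zero_right]
    have h2 : adjoint D (D y) = 0 := inner_self_eq_zero.1 h1
    have h3 : inner ℝ (D y) (D y) = 0 := by
      rw [← adjoint_inner_left, h2, inner_zero_left]
    exact inner_self_eq_zero.1 h3
  let e : V ≃ₗ[ℝ] V := LinearEquiv.ofInjectiveEndo (D ∘L adjoint D : V →L[ℝ] V).toLinearMap hinj
  refine ⟨e.toContinuousLinearEquiv, ?_⟩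
  ext v
  rfl

variable {h : E → V} {x : E}

theorem tangentProj_mem [FiniteDimensional ℝ V] (hs : Function.Surjective (fderiv ℝ h x)) (y : E) :
    tangentProj h x y ∈ tangentAt h x := by
  have hi := isInvertible_comp_adjoint hs
  have key : ((fderiv ℝ h x) ∘L (adjoint (fderiv ℝ h x)))
      (((fderiv ℝ h x) ∘L (adjoint (fderiv ℝ h x))).inverse (fderiv ℝ h x y)) = fderiv ℝ h x y := by
    rw [← comp_apply, hi.self_comp_inverse, id_apply]
  have : fderiv ℝ h x (tangentProj h x y) = 0 := by
    simp only [tangentProj, sub_apply, id_apply, map_sub]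
    rw [sub_eq_zero]
    exact key.symm
  exact this

theorem tangentProj_of_mem {y : E} (hy : y ∈ tangentAt h x) : tangentProj h x y = y := by
  have : fderiv ℝ h x y = 0 := hy
  simp [tangentProj, this]

/-- The part removed by the projection lies in the range of `Dhᵀ`, which is orthogonal to `ker Dh`.
-/
theorem inner_tangentProj {ξ : E} (hξ : ξ ∈ tangentAt h x) (y : E) :
    inner ℝ (tangentProj h x y) ξ = inner ℝ y ξ := by
  have h0 : fderiv ℝ h x ξ = 0 := hξ
  simp [tangentProj, inner_sub_left, adjoint_inner_left, h0]

/-- Over `ℝ` the adjoint is a bounded linear map, hence smooth. -/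
theorem contDiff_adjoint : ContDiff ℝ ∞ (fun D : E →L[ℝ] V => adjoint D) := by
  let A : (E →L[ℝ] V) →L[ℝ] (V →L[ℝ] E) := LinearMap.mkContinuous
    { toFun := fun D => adjoint D
      map_add' := fun a b => map_add _ a b
      map_smul' := fun c a => by simp } 1 (fun a => by simp)
  exact A.contDiff

theorem contDiffAt_tangentProj [FiniteDimensional ℝ V] (hh : ContDiff ℝ ∞ h)
    (hs : Function.Surjective (fderiv ℝ h x)) : ContDiffAt ℝ ∞ (tangentProj h) x := by
  have hD : ContDiff ℝ ∞ (fderiv ℝ h) := hh.fderiv_right (by simp)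
  have hDt : ContDiff ℝ ∞ (fun z => adjoint (fderiv ℝ h z)) := contDiff_adjoint.comp hD
  have hc : ContDiff ℝ ∞ (fun z => (fderiv ℝ h z) ∘L adjoint (fderiv ℝ h z)) := hD.clm_comp hDt
  obtain ⟨e, he⟩ := isInvertible_comp_adjoint hs
  have hinv : ContDiffAt ℝ ∞
      (fun z => ((fderiv ℝ h z) ∘L adjoint (fderiv ℝ h z)).inverse) x := by
    have := contDiffAt_map_inverse (𝕜 := ℝ) (n := ∞) e
    rw [he] at this
    exact this.comp x hc.contDiffAt
  exact contDiffAt_const.sub (hDt.contDiffAt.clm_comp (hinv.clm_comp hD.contDiffAt))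

theorem continuousAt_norm_fderiv_tangentProj [FiniteDimensional ℝ V] (hh : ContDiff ℝ ∞ h)
    (hs : Function.Surjective (fderiv ℝ h x)) :
    ContinuousAt (fun z => ‖fderiv ℝ (tangentProj h) z‖) x := by
  have hD : ContDiffAt ℝ 0 (fderiv ℝ (tangentProj h)) x :=
    (contDiffAt_tangentProj hh hs).fderiv_right (by simp)
  have hn : Continuous fun T : E →L[ℝ] E →L[ℝ] E => ‖T‖ :=
    continuous_norm (E := E →L[ℝ] E →L[ℝ] E)
  exact ContinuousAt.comp (g := fun T : E →L[ℝ] E →L[ℝ] E => ‖T‖) hn.continuousAt hD.continuousAt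

theorem hasGradientAt_norm_sq_sub (π : E →L[ℝ] W) (w : W) (x : E) :
    HasGradientAt (fun z => ‖π z - w‖ ^ 2) ((2 : ℝ) • adjoint π (π x - w)) x := by
  rw [hasGradientAt_iff_hasFDerivAt]
  have h1 : HasFDerivAt (fun z => π z - w) π x := π.hasFDerivAt.sub_const w
  refine h1.norm_sq.congr_fderiv ?_
  ext y
  simp [adjoint_inner_left]

theorem riemGrad_norm_sq_sub (π : E →L[ℝ] W) (w : W) (x : E) :
    riemGrad h (fun z => ‖π z - w‖ ^ 2) x = tangentProj h x ((2 : ℝ) • adjoint π (π x - w)) := by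
  rw [riemGrad, (hasGradientAt_norm_sq_sub π w x).gradient]

theorem inner_riemGrad (π : E →L[ℝ] W) (w : W) {ξ : E} (hξ : ξ ∈ tangentAt h x) :
    inner ℝ (riemGrad h (fun z => ‖π z - w‖ ^ 2) x) ξ = 2 * inner ℝ (π x - w) (π ξ) := by
  rw [riemGrad_norm_sq_sub, inner_tangentProj hξ, inner_smul_left, adjoint_inner_left]
  simp

/-- Removing the projection derivative from the Hessian leaves the Gauss-Newton operator. -/
theorem riemHess_add_hessError [FiniteDimensional ℝ V] (hh : ContDiff ℝ ∞ h)
    (hs : Function.Surjective (fderiv ℝ h x)) (π : E →L[ℝ] W) (w : W) (ξ : E) :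
    riemHess h (fun z => ‖π z - w‖ ^ 2) x ξ + hessError h (fun z => ‖π z - w‖ ^ 2) x ξ =
      tangentProj h x ((2 : ℝ) • adjoint π (π ξ)) := by
  have hP : HasFDerivAt (tangentProj h) (fderiv ℝ (tangentProj h) x) x :=
    ((contDiffAt_tangentProj hh hs).differentiableAt (by simp)).hasFDerivAt
  have hg : HasFDerivAt (fun z => (2 : ℝ) • adjoint π (π z - w))
      ((2 : ℝ) • (adjoint π ∘L π)) x :=
    (((adjoint π).hasFDerivAt).comp x (π.hasFDerivAt.sub_const w)).const_smul (2 : ℝ)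
  have heq : riemGrad h (fun z => ‖π z - w‖ ^ 2) =
      fun z => tangentProj h z ((2 : ℝ) • adjoint π (π z - w)) :=
    funext fun z => riemGrad_norm_sq_sub π w z
  have hd := (hP.clm_apply hg).fderiv
  rw [riemHess, hessError, projDerivTerm, (hasGradientAt_norm_sq_sub π w x).gradient, heq, hd]
  simp only [comp_apply, neg_apply, add_apply, flip_apply, map_add, smul_apply]
  -- The Hessian projects the Gauss-Newton term twice; the second projection changes nothing.
  rw [tangentProj_of_mem (tangentProj_mem hs ((2 : ℝ) • adjoint π (π ξ)))]
  abel

/-- These are the normal equations for minimizing `‖π x - w + π ξ‖` over the tangent space. -/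
theorem isApproxNewtonDirection_iff [FiniteDimensional ℝ V] (hh : ContDiff ℝ ∞ h)
    (hs : Function.Surjective (fderiv ℝ h x)) (π : E →L[ℝ] W) (w : W) (ξ : E) :
    IsApproxNewtonDirection h (fun z => ‖π z - w‖ ^ 2) (hessError h (fun z => ‖π z - w‖ ^ 2) x) x ξ
      ↔ ξ ∈ tangentAt h x ∧ ∀ η ∈ tangentAt h x, inner ℝ (π x - w + π ξ) (π η) = 0 := by
  rw [IsApproxNewtonDirection, riemHess_add_hessError hh hs, riemGrad_norm_sq_sub]
  refine and_congr_right fun hξ => ?_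
  rw [eq_neg_iff_add_eq_zero, ← map_add, ← smul_add, ← map_add, add_comm (π ξ)]
  constructor
  · intro h0 η hη
    have h1 := inner_tangentProj hη ((2 : ℝ) • adjoint π (π x - w + π ξ))
    rw [h0, inner_zero_left, inner_smul_left, adjoint_inner_left] at h1
    simpa using h1.symm
  · intro h0
    -- A projected vector is itself tangent, so the orthogonality can be tested on it and its norm
    -- vanishes.
    have hm := tangentProj_mem hs ((2 : ℝ) • adjoint π (π x - w + π ξ))
    rw [← inner_self_eq_zero (𝕜 := ℝ), inner_tangentProj hm, inner_smul_left, adjoint_inner_left,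
      h0 _ hm, mul_zero]

theorem norm_hessError_le (π : E →L[ℝ] W) (w : W) (x : E) :
    ‖hessError h (fun z => ‖π z - w‖ ^ 2) x‖ ≤
      ‖tangentProj h x‖ * ‖fderiv ℝ (tangentProj h) x‖ * (2 * ‖π‖ * ‖π x - w‖) := by
  rw [hessError, norm_neg, projDerivTerm, (hasGradientAt_norm_sq_sub π w x).gradient]
  refine (opNorm_comp_le _ _).trans ?_
  rw [mul_assoc]
  gcongr
  refine (le_opNorm _ _).trans ?_
  rw [opNorm_flip]
  gcongr
  rw [norm_smul, Real.norm_ofNat, mul_assoc]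
  gcongr
  refine (le_opNorm _ _).trans ?_
  rw [LinearIsometryEquiv.norm_map]

end Projection

/-! ### Differential of the branch flow equations -/

namespace RadialNetwork

variable {J : ℕ} (N : RadialNetwork J)

/-- The linear part of `upV`. -/
def upVLin (v : Fin J → ℝ) (j : Fin J) : ℝ :=
  match N.parent j with
  | none => 0
  | some i => v i

theorem parent_induction {C : Fin J → Prop} (hC : ∀ j, (∀ i, N.parent j = some i → C i) → C j)
    (j : Fin J) : C j :=
  N.parent_wf.induction j hC

theorem contDiffAt_upV {n : WithTop ℕ∞} {E : Type*} [NormedAddCommGroup E] [NormedSpace ℝ E]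
    {v : E → Fin J → ℝ} {x : E} {j : Fin J}
    (hv : ∀ i, N.parent j = some i → ContDiffAt ℝ n (fun y => v y i) x) :
    ContDiffAt ℝ n (fun y => N.upV (v y) j) x := by
  unfold upV
  split
  · exact contDiffAt_const
  · next i hi => exact hv i hi

theorem contDiff_F : ContDiff ℝ ∞ N.F := by
  rw [contDiff_euclidean]
  rintro ⟨c, j⟩
  have hup : ContDiff ℝ ∞ fun x : LFState J => N.upV (fun i => x (3, i)) j :=
    contDiff_iff_contDiffAt.2 fun x => N.contDiffAt_upV fun i _ => by fun_prop
  fin_cases c <;> simp [F, realInj, reactInj, dropV, div_eq_mul_inv] <;> fun_prop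

/-- The differential of the branch flow equations. -/
def dF (x ξ : LFState J) : EuclideanSpace ℝ (Fin 4 × Fin J) :=
  WithLp.toLp 2 fun cj =>
    ![N.realInj (fun i => ξ (0, i)) (fun i => ξ (2, i)) (fun i => ξ (3, i)) cj.2 - ξ (4, cj.2),
      N.reactInj (fun i => ξ (1, i)) (fun i => ξ (2, i)) (fun i => ξ (3, i)) cj.2 - ξ (5, cj.2),
      N.dropV cj.2 (N.upVLin (fun i => ξ (3, i)) cj.2) (ξ (0, cj.2)) (ξ (1, cj.2)) (ξ (2, cj.2))
        - ξ (3, cj.2),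
      N.upVLin (fun i => ξ (3, i)) cj.2 * x (2, cj.2)
        + N.upV (fun i => x (3, i)) cj.2 * ξ (2, cj.2)
        - 2 * (x (0, cj.2) * ξ (0, cj.2) + x (1, cj.2) * ξ (1, cj.2))] cj.1

/-- `F` is quadratic, so its expansion along a line is exact and the derivative is the coefficient
of `t`. -/
theorem fderiv_F_apply (x ξ : LFState J) : fderiv ℝ N.F x ξ = N.dF x ξ := by
  have hF : HasFDerivAt N.F (fderiv ℝ N.F x) x :=
    (N.contDiff_F.differentiable (by simp) x).hasFDerivAt
  have hline : HasDerivAt (fun t : ℝ => x + t • ξ) ξ 0 := by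
    simpa using ((hasDerivAt_id (0 : ℝ)).smul_const ξ).const_add x
  have hF' : HasFDerivAt N.F (fderiv ℝ N.F x) (x + (0 : ℝ) • ξ) := by simpa using hF
  have h1 := hF'.comp_hasDerivAt (0 : ℝ) hline
  refine h1.unique ?_
  have hexp : ∀ t : ℝ, N.F (x + t • ξ) = N.F x + t • N.dF x ξ + t ^ 2 • WithLp.toLp 2 (fun cj =>
      ![0, 0, 0, N.upVLin (fun i => ξ (3, i)) cj.2 * ξ (2, cj.2)
        - (ξ (0, cj.2) ^ 2 + ξ (1, cj.2) ^ 2)] cj.1) := by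
    intro t
    have hup : ∀ j, N.upV (fun i => (x + t • ξ) (3, i)) j =
        N.upV (fun i => x (3, i)) j + t * N.upVLin (fun i => ξ (3, i)) j := by
      intro j
      unfold upV upVLin
      cases h : N.parent j <;> simp
    ext ⟨c, j⟩
    fin_cases c
    · simp [F, dF, realInj, Finset.sum_add_distrib, ← Finset.mul_sum]
      ring
    · simp [F, dF, reactInj, Finset.sum_add_distrib, ← Finset.mul_sum]
      ring
    · simp only [F, hup]
      simp [dF, dropV]
      ring
    · simp only [F, hup]
      simp [dF]
      ring
  rw [show N.F ∘ (fun t : ℝ => x + t • ξ) = _ from funext hexp]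
  have h2 := (((hasDerivAt_id (0 : ℝ)).smul_const (N.dF x ξ)).const_add (N.F x)).fun_add
    (((hasDerivAt_id (0 : ℝ)).pow 2).smul_const (WithLp.toLp 2 (fun cj : Fin 4 × Fin J =>
      ![0, 0, 0, N.upVLin (fun i => ξ (3, i)) cj.2 * ξ (2, cj.2)
        - (ξ (0, cj.2) ^ 2 + ξ (1, cj.2) ^ 2)] cj.1)))
  simpa using h2

/-- A tangent vector is determined by its branch flow components. -/
theorem eq_zero_of_mem_tangentAt {x ξ : LFState J} (hx : ∀ j, N.upV (fun i => x (3, i)) j ≠ 0)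
    (hξ : ξ ∈ tangentAt N.F x) (hP : ∀ j, ξ (0, j) = 0) (hQ : ∀ j, ξ (1, j) = 0) : ξ = 0 := by
  have h0 : N.dF x ξ = 0 := by rw [← N.fderiv_F_apply]; exact hξ
  have hc : ∀ c j, N.dF x ξ (c, j) = 0 := fun c j => by rw [h0]; rfl
  have hlv : ∀ j, ξ (2, j) = 0 ∧ ξ (3, j) = 0 := by
    refine N.parent_induction fun j ih => ?_
    have hu : N.upVLin (fun i => ξ (3, i)) j = 0 := by
      unfold upVLin
      split
      · rfl
      · next i hi => exact (ih i hi).2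
    have h3 := hc 3 j
    simp [dF, hu, hP, hQ, hx j] at h3
    have h2 := hc 2 j
    simp [dF, dropV, hu, hP, hQ, h3] at h2
    exact ⟨h3, h2⟩
  ext ⟨c, j⟩
  have h0j := hc 0 j
  have h1j := hc 1 j
  simp [dF, realInj, reactInj, hP, hQ, hlv] at h0j h1j
  fin_cases c
  · exact hP j
  · exact hQ j
  · exact (hlv j).1
  · exact (hlv j).2
  · exact h0j
  · exact h1j

/-- Adjoining the components `P`, `Q` to `DF(x)` gives an injective map between spaces of dimension
`6J = 4J + 2J`, hence a bijection. -/
theorem surjective_fderiv_F {x : LFState J} (hx : ∀ j, N.upV (fun i => x (3, i)) j ≠ 0) :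
    Function.Surjective (fderiv ℝ N.F x) := by
  let B : LFState J →ₗ[ℝ] (Fin 2 × Fin J → ℝ) :=
    { toFun := fun ξ cj => ![ξ (0, cj.2), ξ (1, cj.2)] cj.1
      map_add' := fun a b => by ext ⟨c, j⟩; fin_cases c <;> simp
      map_smul' := fun a b => by ext ⟨c, j⟩; fin_cases c <;> simp }
  let A : LFState J →ₗ[ℝ] EuclideanSpace ℝ (Fin 4 × Fin J) × (Fin 2 × Fin J → ℝ) :=
    (fderiv ℝ N.F x).toLinearMap.prod B
  have hA : Function.Injective A := by
    rw [injective_iff_map_eq_zero]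
    intro ξ hξ
    have h1 : fderiv ℝ N.F x ξ = 0 := congrArg Prod.fst hξ
    have h2 : B ξ = 0 := congrArg Prod.snd hξ
    exact N.eq_zero_of_mem_tangentAt hx h1 (fun j => congrFun h2 (0, j))
      (fun j => congrFun h2 (1, j))
  have hs : Function.Surjective A :=
    (LinearMap.injective_iff_surjective_of_finrank_eq_finrank (by simp; ring)).1 hA
  intro y
  obtain ⟨ξ, hξ⟩ := hs (y, 0)
  exact ⟨ξ, congrArg Prod.fst hξ⟩

/-! ### The forward sweep -/

/-- The points from which the forward sweep never divides by zero. -/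
def sweepDomain : Set (LFState J) := {y | ∀ j, N.upV (N.sweepV y) j ≠ 0}

/-- Induction from the root: as `v_i ≠ 0`, the equation `v_i l_j = P_j² + Q_j²` forces the swept
value of `l_j`, and the voltage drop then forces `v_j`. -/
theorem sweepV_eq_of_mem {x : LFState J} (hx : x ∈ N.manifold) : N.sweepV x = fun i => x (3, i) := by
  obtain ⟨h0, hne⟩ := hx
  have hc : ∀ c j, N.F x (c, j) = 0 := fun c j => by rw [h0]; rfl
  funext j
  refine N.parent_induction (C := fun j => N.sweepV x j = x (3, j)) (fun j ih => ?_) j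
  have hu : N.upV (N.sweepV x) j = N.upV (fun i => x (3, i)) j := by
    unfold upV
    split
    · rfl
    · next i hi => exact ih i hi
  rw [sweepV_eq, hu]
  have h3 := hc 3 j
  have h2 := hc 2 j
  simp only [F, Matrix.cons_val] at h2 h3
  rw [← sub_eq_zero.1 h3, mul_div_cancel_left₀ _ (hne j), sub_eq_zero.1 h2]

theorem mem_sweepDomain_of_mem {x : LFState J} (hx : x ∈ N.manifold) : x ∈ N.sweepDomain := by
  intro j
  rw [N.sweepV_eq_of_mem hx]
  exact hx.2 j

theorem sweep_of_mem {x : LFState J} (hx : x ∈ N.manifold) : N.sweep x = x := by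
  have hv := N.sweepV_eq_of_mem hx
  obtain ⟨h0, hne⟩ := hx
  have hc : ∀ c j, N.F x (c, j) = 0 := fun c j => by rw [h0]; rfl
  have hl : N.sweepL x = fun j => x (2, j) := by
    funext j
    have h3 := hc 3 j
    simp only [F, Matrix.cons_val] at h3
    rw [sweepL, hv, ← sub_eq_zero.1 h3, mul_div_cancel_left₀ _ (hne j)]
  ext ⟨c, j⟩
  have h4 := hc 0 j
  have h5 := hc 1 j
  simp only [F, Matrix.cons_val] at h4 h5
  simp only [sweep, hv, hl]
  fin_cases c
  · rfl
  · rfl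
  · rfl
  · rfl
  · exact sub_eq_zero.1 h4
  · exact sub_eq_zero.1 h5

theorem sweep_mem {y : LFState J} (hy : y ∈ N.sweepDomain) : N.sweep y ∈ N.manifold := by
  refine ⟨?_, hy⟩
  ext ⟨c, j⟩
  fin_cases c
  · simp [F, sweep]
  · simp [F, sweep]
  · have := N.sweepV_eq y j
    simp [F, sweep]
    rw [sub_eq_zero]
    exact this.symm
  · simp [F, sweep, sweepL]
    rw [sub_eq_zero]
    exact mul_div_cancel₀ _ (hy j)

theorem contDiffAt_sweepV {y : LFState J} (hy : y ∈ N.sweepDomain) (j : Fin J) :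
    ContDiffAt ℝ ∞ (fun z => N.sweepV z j) y := by
  refine N.parent_induction (C := fun j => ContDiffAt ℝ ∞ (fun z => N.sweepV z j) y)
    (fun j ih => ?_) j
  have hu : ContDiffAt ℝ ∞ (fun z => N.upV (N.sweepV z) j) y := N.contDiffAt_upV ih
  have h0 := hy j
  have hl : ContDiffAt ℝ ∞
      (fun z : LFState J => (z (0, j) ^ 2 + z (1, j) ^ 2) / N.upV (N.sweepV z) j) y :=
    ContDiffAt.div (by fun_prop) hu h0
  simp_rw [N.sweepV_eq _ j, dropV, div_eq_mul_inv (N.upV _ _) (N.tap j ^ 2)]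
  fun_prop

theorem contDiffAt_upV_sweepV {y : LFState J} (hy : y ∈ N.sweepDomain) (j : Fin J) :
    ContDiffAt ℝ ∞ (fun z => N.upV (N.sweepV z) j) y :=
  N.contDiffAt_upV fun i _ => N.contDiffAt_sweepV hy i

theorem contDiffAt_sweep {y : LFState J} (hy : y ∈ N.sweepDomain) :
    ContDiffAt ℝ ∞ N.sweep y := by
  have hv := N.contDiffAt_sweepV hy
  have hl : ∀ j, ContDiffAt ℝ ∞ (fun z => N.sweepL z j) y := fun j =>
    ContDiffAt.div (by fun_prop) (N.contDiffAt_upV_sweepV hy j) (hy j)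
  rw [contDiffAt_euclidean]
  rintro ⟨c, j⟩
  fin_cases c <;> simp [sweep, realInj, reactInj] <;> fun_prop

theorem isOpen_sweepDomain : IsOpen N.sweepDomain := by
  rw [isOpen_iff_mem_nhds]
  intro y hy
  exact eventually_all.2 fun j => (N.contDiffAt_upV_sweepV hy j).continuousAt.eventually_ne (hy j)

theorem mem_retrDomain_iff {x ξ : LFState J} : ξ ∈ N.retrDomain x ↔ x + ξ ∈ N.sweepDomain := Iff.rfl

/-- The sweep fixes tangent vectors of the manifold to first order. -/
theorem fderiv_sweep_apply {x ξ : LFState J} (hx : x ∈ N.manifold) (hξ : ξ ∈ tangentAt N.F x) :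
    fderiv ℝ N.sweep x ξ = ξ := by
  have hxd := N.mem_sweepDomain_of_mem hx
  have hS : HasFDerivAt N.sweep (fderiv ℝ N.sweep x) x :=
    ((N.contDiffAt_sweep hxd).differentiableAt (by simp)).hasFDerivAt
  have hF : HasFDerivAt N.F (fderiv ℝ N.F x) (N.sweep x) := by
    rw [N.sweep_of_mem hx]
    exact (N.contDiff_F.differentiable (by simp) x).hasFDerivAt
  -- `F ∘ sweep` vanishes near `x`, so the derivative of the sweep takes values in the tangent
  -- space.
  have hFS : HasFDerivAt (fun y => N.F (N.sweep y)) (0 : LFState J →L[ℝ] _) x := by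
    refine (hasFDerivAt_const (0 : EuclideanSpace ℝ (Fin 4 × Fin J)) x).congr_of_eventuallyEq ?_
    filter_upwards [N.isOpen_sweepDomain.mem_nhds hxd] with y hy using (N.sweep_mem hy).1
  have h1 : fderiv ℝ N.F x (fderiv ℝ N.sweep x ξ) = 0 :=
    DFunLike.congr_fun ((hF.comp x hS).unique hFS) ξ
  have hcoord : ∀ c : Fin 6 × Fin J, (∀ y, N.sweep y c = y c) → fderiv ℝ N.sweep x ξ c = ξ c := by
    intro c hc
    have h2 := (EuclideanSpace.proj (𝕜 := ℝ) c).hasFDerivAt.comp x hS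
    have h3 : (EuclideanSpace.proj (𝕜 := ℝ) c) ∘ N.sweep =
        (EuclideanSpace.proj (𝕜 := ℝ) c : LFState J → ℝ) := funext hc
    rw [h3] at h2
    exact DFunLike.congr_fun (h2.unique (EuclideanSpace.proj (𝕜 := ℝ) c).hasFDerivAt) ξ
  -- This tangent vector has zero `P`, `Q` components because the sweep keeps them, so it is zero.
  have h4 : fderiv ℝ N.sweep x ξ - ξ ∈ tangentAt N.F x := sub_mem h1 hξ
  refine sub_eq_zero.1 (N.eq_zero_of_mem_tangentAt hx.2 h4 (fun j => ?_) fun j => ?_)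
  · simp [hcoord (0, j) fun _ => rfl]
  · simp [hcoord (1, j) fun _ => rfl]

theorem retr_mem {x ξ : LFState J} (hξ : ξ ∈ N.retrDomain x) : N.retr x ξ ∈ N.manifold :=
  N.sweep_mem hξ

theorem hasDerivAt_retr {x ξ : LFState J} (hx : x ∈ N.manifold) (hξ : ξ ∈ tangentAt N.F x) :
    HasDerivAt (fun t : ℝ => N.retr x (t • ξ)) ξ 0 := by
  have hline : HasDerivAt (fun t : ℝ => x + t • ξ) ξ 0 := by
    simpa using ((hasDerivAt_id (0 : ℝ)).smul_const ξ).const_add x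
  have hS : HasFDerivAt N.sweep (fderiv ℝ N.sweep x) (x + (0 : ℝ) • ξ) := by
    rw [zero_smul, add_zero]
    exact ((N.contDiffAt_sweep (N.mem_sweepDomain_of_mem hx)).differentiableAt
      (by simp)).hasFDerivAt
  have := hS.comp_hasDerivAt (0 : ℝ) hline
  rwa [N.fderiv_sweep_apply hx hξ] at this

theorem contDiffOn_retr (x : LFState J) (T : Submodule ℝ (LFState J)) :
    ContDiffOn ℝ ∞ (fun ξ : T => N.retr x ξ) {ξ : T | (ξ : LFState J) ∈ N.retrDomain x} := by
  intro ξ hξ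
  have h1 : ContDiff ℝ ∞ fun ξ : T => x + (ξ : LFState J) :=
    contDiff_const.add T.subtypeL.contDiff
  have h2 : ContDiffAt ℝ ∞ N.sweep (x + (ξ : LFState J)) := N.contDiffAt_sweep hξ
  exact (ContDiffAt.comp ξ h2 h1.contDiffAt).contDiffWithinAt

theorem isOpen_retrDomain (x : LFState J) (T : Submodule ℝ (LFState J)) :
    IsOpen {ξ : T | (ξ : LFState J) ∈ N.retrDomain x} := by
  have hc : Continuous fun ξ : T => x + (ξ : LFState J) := by fun_prop
  exact N.isOpen_sweepDomain.preimage hc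

theorem isRetractionAt {x : LFState J} (hx : x ∈ N.manifold) :
    IsRetractionAt N.F x (N.retrDomain x) (N.retr x) where
  isOpen_domain := N.isOpen_retrDomain x _
  zero_mem := by
    rw [mem_retrDomain_iff, add_zero]
    exact N.mem_sweepDomain_of_mem hx
  smooth := N.contDiffOn_retr x _
  maps_to := fun ξ _ hξ => (N.retr_mem hξ).1
  centering := by rw [retr, add_zero, N.sweep_of_mem hx]
  local_rigidity := fun ξ hξ => N.hasDerivAt_retr hx hξ

end RadialNetwork

/-! ### Superlinear convergence from a one-step estimate -/

section Superlinear

variable {E : Type*} [NormedAddCommGroup E]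

/-- The factor `1/2` keeps the sequence in the ball, where the recursion is known, and forces
convergence; only then does the little-o estimate give the rate. -/
theorem convergesSuperlinearly_of_step {M : Set E} {T : E → E} {xs : E} {r : ℝ}
    (hT : (fun y => T y - xs) =o[𝓝[M] xs] fun y => y - xs)
    (hr : ∀ y ∈ M, ‖y - xs‖ < r → ‖T y - xs‖ ≤ 1 / 2 * ‖y - xs‖)
    {x : ℕ → E} (hM : ∀ k, x k ∈ M) (h0 : ‖x 0 - xs‖ < r)
    (hx : ∀ k, ‖x k - xs‖ < r → x (k + 1) = T (x k)) : ConvergesSuperlinearly x xs := by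
  have hball : ∀ k, ‖x k - xs‖ < r ∧ ‖x k - xs‖ ≤ (1 / 2) ^ k * ‖x 0 - xs‖ := by
    intro k
    induction k with
    | zero => simpa using h0
    | succ k ih =>
      have h1 : ‖x (k + 1) - xs‖ ≤ 1 / 2 * ‖x k - xs‖ := by
        rw [hx k ih.1]
        exact hr _ (hM k) ih.1
      refine ⟨by linarith [norm_nonneg (x k - xs), ih.1], ?_⟩
      rw [pow_succ']
      linarith [ih.2]
  have hlim : Tendsto x atTop (𝓝 xs) := by
    rw [tendsto_iff_norm_sub_tendsto_zero]
    refine squeeze_zero (fun _ => norm_nonneg _) (fun k => (hball k).2) ?_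
    simpa using (tendsto_pow_atTop_nhds_zero_of_lt_one (by norm_num : (0 : ℝ) ≤ 1 / 2)
      (by norm_num)).mul_const ‖x 0 - xs‖
  refine ⟨hlim, ?_⟩
  have hlimM : Tendsto x atTop (𝓝[M] xs) :=
    tendsto_nhdsWithin_iff.2 ⟨hlim, Eventually.of_forall hM⟩
  have := (hT.comp_tendsto hlimM).norm_norm
  refine this.congr_left fun k => ?_
  simp only [Function.comp_apply, hx k (hball k).1]

end Superlinear

/-! ### The square linear system for the direction -/

namespace RadialNetwork

variable {J : ℕ} (N : RadialNetwork J)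

/-- The block `w` of `x` as a continuous linear map. -/
def injectionsL (J : ℕ) : LFState J →L[ℝ] Injections J :=
  LinearMap.toContinuousLinearMap
    { toFun := injectionsOf
      map_add' := fun a b => by ext ⟨c, j⟩; fin_cases c <;> simp [injectionsOf]
      map_smul' := fun a b => by ext ⟨c, j⟩; fin_cases c <;> simp [injectionsOf] }

theorem cost_eq (wbar : Injections J) :
    cost wbar = fun z => ‖injectionsL J z - wbar‖ ^ 2 := rfl

theorem cost_nonneg (wbar : Injections J) (x : LFState J) : 0 ≤ cost wbar x := sq_nonneg _

theorem contDiff_cost (wbar : Injections J) : ContDiff ℝ ∞ (cost wbar) :=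
  ((injectionsL J).contDiff.sub contDiff_const).norm_sq ℝ

/-- The coefficient map of the linear system for the direction. -/
def systemMap (x : LFState J) : LFState J →L[ℝ] EuclideanSpace ℝ (Fin 4 × Fin J) × Injections J :=
  (fderiv ℝ N.F x).prod (injectionsL J)

/-- The direction obtained by solving the linear system. -/
def newtonDir (wbar : Injections J) (x : LFState J) : LFState J :=
  (N.systemMap x).inverse (0, wbar - injectionsL J x)

theorem RowsIndependent.isInvertible {N : RadialNetwork J} {x : LFState J}
    (h : N.RowsIndependent x) : (N.systemMap x).IsInvertible := by
  have hs : Function.Surjective (N.systemMap x) := h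
  have hi : Function.Injective (N.systemMap x) :=
    (LinearMap.injective_iff_surjective_of_finrank_eq_finrank
      (f := (N.systemMap x).toLinearMap) (by simp; ring)).2 hs
  exact ⟨(LinearEquiv.ofBijective (N.systemMap x).toLinearMap ⟨hi, hs⟩).toContinuousLinearEquiv, rfl⟩

theorem isDirection_iff (wbar : Injections J) (x ξ : LFState J) :
    N.IsDirection wbar x ξ ↔ N.systemMap x ξ = (0, wbar - injectionsL J x) := by
  rw [Prod.ext_iff, eq_sub_iff_add_eq']
  rfl

theorem isDirection_iff_eq {wbar : Injections J} {x : LFState J}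
    (h : (N.systemMap x).IsInvertible) (ξ : LFState J) :
    N.IsDirection wbar x ξ ↔ ξ = N.newtonDir wbar x := by
  rw [isDirection_iff, newtonDir]
  obtain ⟨e, he⟩ := h
  rw [← he, ContinuousLinearMap.inverse_equiv]
  exact e.eq_symm_apply.symm

theorem IsDirection.injectionsL_eq {N : RadialNetwork J} {wbar : Injections J} {x ξ : LFState J}
    (h : N.IsDirection wbar x ξ) : injectionsL J ξ = -(injectionsL J x - wbar) := by
  rw [neg_sub]
  exact congrArg Prod.snd ((N.isDirection_iff wbar x ξ).1 h)

theorem IsDirection.inner_grad {N : RadialNetwork J} {wbar : Injections J} {x ξ : LFState J}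
    (h : N.IsDirection wbar x ξ) : inner ℝ (N.grad wbar x) ξ = -2 * cost wbar x := by
  rw [grad, cost_eq, inner_riemGrad _ _ h.1, h.injectionsL_eq, inner_neg_right,
    real_inner_self_eq_norm_sq]
  ring

theorem grad_eq_zero_of_cost_eq_zero {wbar : Injections J} {x : LFState J}
    (h : cost wbar x = 0) : N.grad wbar x = 0 := by
  have h0 : injectionsL J x - wbar = 0 := by simpa [cost_eq] using h
  rw [grad, cost_eq, riemGrad_norm_sq_sub, h0]
  simp

theorem cost_pos {wbar : Injections J} {x : LFState J} (h : N.grad wbar x ≠ 0) :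
    0 < cost wbar x :=
  (cost_nonneg wbar x).lt_of_ne' fun h0 => h (N.grad_eq_zero_of_cost_eq_zero h0)

/-- With `r` the mismatch and `ξ` the direction, `2‖r‖² = |⟨grad f, ξ⟩| ≤ ‖grad f‖ ‖A⁻¹‖ ‖r‖`.
Dividing by `‖r‖` gives the bound, with a factor 2 to spare. -/
theorem norm_injections_sub_le {wbar : Injections J} {x : LFState J}
    (h : (N.systemMap x).IsInvertible) :
    ‖injectionsL J x - wbar‖ ≤ ‖(N.systemMap x).inverse‖ * ‖N.grad wbar x‖ := by
  have hd : N.IsDirection wbar x (N.newtonDir wbar x) := (N.isDirection_iff_eq h _).2 rfl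
  have h1 := hd.inner_grad
  have h2 := abs_real_inner_le_norm (N.grad wbar x) (N.newtonDir wbar x)
  rw [h1, cost_eq, abs_le] at h2
  have h3 : ‖N.newtonDir wbar x‖ ≤ ‖(N.systemMap x).inverse‖ * ‖injectionsL J x - wbar‖ := by
    refine (ContinuousLinearMap.le_opNorm _ _).trans_eq ?_
    rw [Prod.norm_mk, norm_zero, max_eq_right (norm_nonneg _), norm_sub_rev]
  have h4 := mul_le_mul_of_nonneg_left h3 (norm_nonneg (N.grad wbar x))
  rcases (norm_nonneg (injectionsL J x - wbar)).eq_or_lt with h0 | h0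
  · rw [← h0]; positivity
  · refine le_of_mul_le_mul_right ?_ h0
    nlinarith [h2.1]

theorem cost_eq_zero_of_grad_eq_zero {wbar : Injections J} {x : LFState J}
    (h : (N.systemMap x).IsInvertible) (hg : N.grad wbar x = 0) : cost wbar x = 0 := by
  have := N.norm_injections_sub_le (wbar := wbar) h
  rw [hg, norm_zero, mul_zero] at this
  rw [cost_eq]
  simpa using this

theorem continuous_systemMap : Continuous N.systemMap := by
  have h1 : Continuous (fderiv ℝ N.F) := N.contDiff_F.continuous_fderiv (by simp)
  exact (ContinuousLinearMap.prodₗᵢ ℝ).continuous.comp (h1.prodMk continuous_const)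

theorem continuousAt_inverse_systemMap {x : LFState J} (h : (N.systemMap x).IsInvertible) :
    ContinuousAt (fun z => (N.systemMap z).inverse) x :=
  ContinuousAt.comp (g := ContinuousLinearMap.inverse)
    (h.contDiffAt_map_inverse (n := 0)).continuousAt N.continuous_systemMap.continuousAt

theorem eventually_isInvertible {x : LFState J} (h : (N.systemMap x).IsInvertible) :
    ∀ᶠ z in 𝓝 x, (N.systemMap z).IsInvertible := by
  obtain ⟨e, he⟩ := h
  have h1 := e.nhds
  rw [he] at h1
  filter_upwards [N.continuous_systemMap.continuousAt h1] with z hz using hz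

theorem continuousAt_newtonDir (wbar : Injections J) {x : LFState J}
    (h : (N.systemMap x).IsInvertible) : ContinuousAt (N.newtonDir wbar) x := by
  refine (N.continuousAt_inverse_systemMap h).clm_apply ?_
  fun_prop

/-- `E_x` is bounded by the mismatch, hence by the gradient, with a factor that is continuous on
`K`. -/
theorem exists_norm_hessError_le (wbar : Injections J) {K : Set (LFState J)} (hK : IsCompact K)
    (hKM : K ⊆ {x ∈ N.manifold | N.RowsIndependent x}) :
    ∃ γ : ℝ, ∀ x ∈ K, ‖hessError N.F (cost wbar) x‖ ≤ γ * ‖N.grad wbar x‖ := by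
  have hc : ContinuousOn (fun x => ‖tangentProj N.F x‖ * ‖fderiv ℝ (tangentProj N.F) x‖ *
      (2 * ‖injectionsL J‖ * ‖(N.systemMap x).inverse‖)) K := by
    intro x hx
    have hP := contDiffAt_tangentProj N.contDiff_F (N.surjective_fderiv_F (hKM hx).1.2)
    have hI := N.continuousAt_inverse_systemMap (hKM hx).2.isInvertible
    have hDn := continuousAt_norm_fderiv_tangentProj N.contDiff_F
      (N.surjective_fderiv_F (hKM hx).1.2)
    exact ((hP.continuousAt.norm.mul hDn).mul
      (continuousAt_const.mul hI.norm)).continuousWithinAt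
  obtain ⟨γ, hγ⟩ := hK.exists_bound_of_continuousOn hc
  refine ⟨γ, fun x hx => ?_⟩
  rw [cost_eq]
  refine (norm_hessError_le _ _ _).trans ?_
  have h1 := N.norm_injections_sub_le (wbar := wbar) (hKM hx).2.isInvertible
  refine le_trans ?_ (mul_le_mul_of_nonneg_right ((le_abs_self _).trans (hγ x hx)) (norm_nonneg _))
  rw [mul_assoc (_ * _), mul_assoc (2 * _)]
  gcongr

/-! ### Directions and the approximate Newton equation -/

theorem IsDirection.isApproxNewtonDirection {N : RadialNetwork J} {wbar : Injections J}
    {x ξ : LFState J} (hx : x ∈ N.manifold) (h : N.IsDirection wbar x ξ) :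
    IsApproxNewtonDirection N.F (cost wbar) (hessError N.F (cost wbar) x) x ξ := by
  rw [cost_eq, isApproxNewtonDirection_iff N.contDiff_F (N.surjective_fderiv_F hx.2)]
  refine ⟨h.1, fun η _ => ?_⟩
  rw [h.injectionsL_eq, add_neg_cancel, inner_zero_left]

theorem existsUnique_isDirection (wbar : Injections J) {x : LFState J} (h : N.RowsIndependent x) :
    ∃! ξ, N.IsDirection wbar x ξ :=
  ⟨N.newtonDir wbar x, (N.isDirection_iff_eq h.isInvertible _).2 rfl,
    fun _ hξ => (N.isDirection_iff_eq h.isInvertible _).1 hξ⟩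

theorem existsUnique_isApproxNewtonDirection (wbar : Injections J) {x : LFState J}
    (hx : x ∈ N.manifold) (h : N.RowsIndependent x) :
    ∃! ξ, IsApproxNewtonDirection N.F (cost wbar) (hessError N.F (cost wbar) x) x ξ := by
  obtain ⟨ξ, hξ, huniq⟩ := N.existsUnique_isDirection wbar h
  refine ⟨ξ, hξ.isApproxNewtonDirection hx, fun ζ hζ => huniq ζ ?_⟩
  rw [cost_eq, isApproxNewtonDirection_iff N.contDiff_F (N.surjective_fderiv_F hx.2)] at hζ
  refine ⟨hζ.1, ?_⟩
  -- The residual at `ζ` is the `w` block of `ζ - ξ`; testing against `ζ - ξ` shows that its norm is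
  -- zero.
  have h1 := hζ.2 (ζ - ξ) (sub_mem hζ.1 hξ.1)
  have h2 : injectionsL J (ζ - ξ) = injectionsL J x - wbar + injectionsL J ζ := by
    rw [map_sub, hξ.injectionsL_eq]
    abel
  rw [h2, inner_self_eq_zero, sub_add_eq_add_sub, sub_eq_zero] at h1
  exact h1

/-! ### The Armijo search -/

theorem hasStrictFDerivAt_cost_sweep (wbar : Injections J) {x : LFState J} (hx : x ∈ N.manifold) :
    HasStrictFDerivAt (fun y => cost wbar (N.sweep y))
      (fderiv ℝ (fun y => cost wbar (N.sweep y)) x) x := by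
  have h1 : ContDiffAt ℝ ∞ (fun y => cost wbar (N.sweep y)) x :=
    (contDiff_cost wbar).contDiffAt.comp x (N.contDiffAt_sweep (N.mem_sweepDomain_of_mem hx))
  exact h1.hasStrictFDerivAt (by simp)

theorem IsDirection.fderiv_cost_sweep {N : RadialNetwork J} {wbar : Injections J}
    {x ξ : LFState J} (hx : x ∈ N.manifold) (h : N.IsDirection wbar x ξ) :
    fderiv ℝ (fun y => cost wbar (N.sweep y)) x ξ = -2 * cost wbar x := by
  have hS : HasFDerivAt N.sweep (fderiv ℝ N.sweep x) x :=
    ((N.contDiffAt_sweep (N.mem_sweepDomain_of_mem hx)).differentiableAt (by simp)).hasFDerivAt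
  have hf : HasFDerivAt (cost wbar) _ (N.sweep x) :=
    (hasGradientAt_norm_sq_sub (injectionsL J) wbar (N.sweep x)).hasFDerivAt
  have hfS := (hf.comp x hS).fderiv
  rw [Function.comp_def] at hfS
  rw [hfS, N.sweep_of_mem hx]
  simp only [ContinuousLinearMap.comp_apply, N.fderiv_sweep_apply hx h.1]
  simp only [map_smul, InnerProductSpace.toDual_apply_apply, smul_eq_mul,
    smul_apply, ContinuousLinearMap.adjoint_inner_left, h.injectionsL_eq,
    inner_neg_right, real_inner_self_eq_norm_sq, cost_eq]
  ring

/-- The Armijo test is passed by all small steps, uniformly near a noncritical point. -/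
theorem eventually_armijoTest {wbar : Injections J} {σ : ℝ} (hσ : σ < 1) {x₀ ξ₀ : LFState J}
    (hx₀ : x₀ ∈ N.manifold) (hξ₀ : N.IsDirection wbar x₀ ξ₀) (hc : 0 < cost wbar x₀) :
    ∀ᶠ p : LFState J × LFState J × ℝ in 𝓝 (x₀, ξ₀, 0), p.1 ∈ N.manifold →
      N.IsDirection wbar p.1 p.2.1 → 0 < p.2.2 → N.ArmijoTest wbar σ p.1 p.2.1 p.2.2 := by
  set φ' := fderiv ℝ (fun y => cost wbar (N.sweep y)) x₀ with hφ'
  have hpt : Tendsto (fun p : LFState J × LFState J × ℝ => p.1 + p.2.2 • p.2.1)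
      (𝓝 (x₀, ξ₀, 0)) (𝓝 x₀) := by
    have : Continuous (fun p : LFState J × LFState J × ℝ => p.1 + p.2.2 • p.2.1) := by fun_prop
    simpa using this.tendsto (x₀, ξ₀, 0)
  have hfst : Tendsto (fun p : LFState J × LFState J × ℝ => p.1) (𝓝 (x₀, ξ₀, 0)) (𝓝 x₀) :=
    continuous_fst.tendsto _
  have hdom : ∀ᶠ p : LFState J × LFState J × ℝ in 𝓝 (x₀, ξ₀, 0),
      p.1 + p.2.2 • p.2.1 ∈ N.sweepDomain :=
    hpt (N.isOpen_sweepDomain.mem_nhds (N.mem_sweepDomain_of_mem hx₀))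
  -- Strict differentiability lets both points `x + α ξ` and `x` move, which makes the estimate
  -- uniform in `x`.
  have ho := (N.hasStrictFDerivAt_cost_sweep wbar hx₀).isLittleO.comp_tendsto
    (hpt.prodMk_nhds hfst)
  -- Chosen so that the linearization error is at most `α (1 - σ) f(x₀) / 2` as long as `‖ξ‖ < ‖ξ₀‖
  -- + 1`.
  have hδ : 0 < (1 - σ) * cost wbar x₀ / (2 * (‖ξ₀‖ + 1)) := by
    have : 0 < 1 - σ := by linarith
    positivity
  have hb := ho.bound hδ
  have hn : ∀ᶠ p : LFState J × LFState J × ℝ in 𝓝 (x₀, ξ₀, 0), ‖p.2.1‖ < ‖ξ₀‖ + 1 := by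
    have : Continuous (fun p : LFState J × LFState J × ℝ => ‖p.2.1‖) := by fun_prop
    exact this.tendsto (x₀, ξ₀, 0) (gt_mem_nhds (by simp))
  -- At `(x₀, ξ₀)` this equals `(3/2) (1 - σ) f(x₀)`, since the derivative along `ξ₀` is `-2 f(x₀)`.
  have hm : ∀ᶠ p : LFState J × LFState J × ℝ in 𝓝 (x₀, ξ₀, 0),
      0 < -φ' p.2.1 - (1 - σ) * cost wbar x₀ / 2 - 2 * σ * cost wbar p.1 := by
    have hcc := (contDiff_cost wbar).continuous
    have : Continuous (fun p : LFState J × LFState J × ℝ =>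
      -φ' p.2.1 - (1 - σ) * cost wbar x₀ / 2 - 2 * σ * cost wbar p.1) := by fun_prop
    refine this.tendsto (x₀, ξ₀, 0) (lt_mem_nhds ?_)
    simp only [hφ', hξ₀.fderiv_cost_sweep hx₀]
    nlinarith
  filter_upwards [hdom, hb, hn, hm] with p h1 h2 h3 h4 hpM hpd hp
  refine ⟨h1, ?_⟩
  rw [inner_smul_right, hpd.inner_grad]
  simp only [Function.comp_apply, add_sub_cancel_left, N.sweep_of_mem hpM] at h2
  rw [norm_smul, Real.norm_of_nonneg hp.le, map_smul, smul_eq_mul, Real.norm_eq_abs] at h2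
  have h5 := (abs_le.1 h2).2
  have h6 : (1 - σ) * cost wbar x₀ / (2 * (‖ξ₀‖ + 1)) * (p.2.2 * ‖p.2.1‖) ≤
      p.2.2 * ((1 - σ) * cost wbar x₀ / 2) := by
    calc _ ≤ (1 - σ) * cost wbar x₀ / (2 * (‖ξ₀‖ + 1)) * (p.2.2 * (‖ξ₀‖ + 1)) := by gcongr
      _ = _ := by field_simp
  have h7 := mul_pos hp h4
  simp only [retr]
  nlinarith

theorem IsDirection.exists_armijoTest {N : RadialNetwork J} {wbar : Injections J} {αbar β σ : ℝ}
    (hα : 0 < αbar) (hβ : 0 < β ∧ β < 1) (hσ : σ < 1) {x ξ : LFState J} (hx : x ∈ N.manifold)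
    (h : N.IsDirection wbar x ξ) (hc : 0 < cost wbar x) :
    ∃ n : ℕ, N.ArmijoTest wbar σ x ξ (β ^ n * αbar) := by
  have hlim : Tendsto (fun n : ℕ => (x, ξ, β ^ n * αbar)) atTop (𝓝 (x, ξ, 0)) := by
    refine tendsto_const_nhds.prodMk_nhds (tendsto_const_nhds.prodMk_nhds ?_)
    simpa using (tendsto_pow_atTop_nhds_zero_of_lt_one hβ.1.le hβ.2).mul_const αbar
  obtain ⟨n, hn⟩ := (hlim.eventually (N.eventually_armijoTest hσ hx h hc)).exists
  exact ⟨n, hn hx h (mul_pos (pow_pos hβ.1 n) hα)⟩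

/-! ### Descent and accumulation points of the method -/

section Run

variable {N} {wbar : Injections J} {αbar β σ ε : ℝ} {x ξ : ℕ → LFState J} {m : ℕ → ℕ}

theorem IsRun.mem_manifold (h : N.IsRun wbar αbar β σ ε x ξ m) (k : ℕ) : x k ∈ N.manifold := by
  induction k with
  | zero => exact h.init
  | succ k ih =>
    rcases lt_or_ge ε ‖N.grad wbar (x k)‖ with hk | hk
    · rw [h.step k hk]
      exact N.retr_mem (h.armijo k hk).1.1
    · rwa [h.halt k hk]

theorem IsRun.cost_decrease (h : N.IsRun wbar αbar β σ ε x ξ m) {k : ℕ}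
    (hk : ε < ‖N.grad wbar (x k)‖) :
    2 * σ * (β ^ m k * αbar) * cost wbar (x k) ≤ cost wbar (x k) - cost wbar (x (k + 1)) := by
  have h1 := (h.armijo k hk).1.2
  rw [inner_smul_right, (h.direction k hk).inner_grad, ← h.step k hk] at h1
  linarith

theorem IsRun.cost_lt (h : N.IsRun wbar αbar β σ ε x ξ m) (hα : 0 < αbar) (hβ : 0 < β)
    (hσ : 0 < σ) (hε : 0 ≤ ε) {k : ℕ} (hk : ε < ‖N.grad wbar (x k)‖) :
    cost wbar (x (k + 1)) < cost wbar (x k) := by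
  have h1 := h.cost_decrease hk
  have h2 : 0 < cost wbar (x k) := N.cost_pos (norm_pos_iff.1 (hε.trans_lt hk))
  have : 0 < 2 * σ * (β ^ m k * αbar) * cost wbar (x k) := by positivity
  linarith

theorem IsRun.antitone_cost (h : N.IsRun wbar αbar β σ ε x ξ m) (hα : 0 < αbar) (hβ : 0 < β)
    (hσ : 0 < σ) (hε : 0 ≤ ε) : Antitone fun k => cost wbar (x k) := by
  refine antitone_nat_of_succ_le fun k => ?_
  rcases lt_or_ge ε ‖N.grad wbar (x k)‖ with hk | hk
  · exact (h.cost_lt hα hβ hσ hε hk).le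
  · rw [h.halt k hk]

/-- Near a nondegenerate noncritical point the decrease of the cost is bounded below. -/
theorem IsRun.exists_eventually_decrease (h : N.IsRun wbar αbar β σ ε x ξ m) (hα : 0 < αbar)
    (hβ : 0 < β ∧ β < 1) (hσ : 0 < σ ∧ σ < 1) {xs : LFState J} (hxs : xs ∈ N.manifold)
    (hr : N.RowsIndependent xs) (hc : 0 < cost wbar xs) :
    ∃ κ > 0, ∀ᶠ y in 𝓝 xs, ∀ k, x k = y → ε < ‖N.grad wbar (x k)‖ →
      κ ≤ cost wbar (x k) - cost wbar (x (k + 1)) := by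
  have hi := hr.isInvertible
  have hd : N.IsDirection wbar xs (N.newtonDir wbar xs) := (N.isDirection_iff_eq hi _).2 rfl
  have hlim : Tendsto (fun p : LFState J × ℝ => (p.1, N.newtonDir wbar p.1, p.2))
      (𝓝 xs ×ˢ 𝓝 0) (𝓝 (xs, N.newtonDir wbar xs, 0)) :=
    tendsto_fst.prodMk_nhds
      (((N.continuousAt_newtonDir wbar hi).tendsto.comp tendsto_fst).prodMk_nhds tendsto_snd)
  -- The neighbourhood splits into one of points `y` and one of step sizes, so a single `δ` serves
  -- all `y` near `xs`.
  obtain ⟨pa, hpa, pb, hpb, hpab⟩ := eventually_prod_iff.1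
    (hlim.eventually (N.eventually_armijoTest hσ.2 hxs hd hc))
  obtain ⟨δ, hδ, hδb⟩ := Metric.eventually_nhds_iff.1 hpb
  have hmin : 0 < min αbar (β * δ) := lt_min hα (mul_pos hβ.1 hδ)
  have hcost : ∀ᶠ y in 𝓝 xs, cost wbar xs / 2 < cost wbar y :=
    (contDiff_cost wbar).continuous.tendsto xs (lt_mem_nhds (half_lt_self hc))
  -- The guaranteed decrease is `2σ α f`, with step `α ≥ min αbar (β δ)` and `f ≥ f(xs) / 2` near
  -- `xs`.
  refine ⟨2 * σ * min αbar (β * δ) * (cost wbar xs / 2), ?_, ?_⟩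
  · have := hσ.1
    positivity
  filter_upwards [hpa, N.eventually_isInvertible hi, hcost] with y hy hyi hyc k hk hgrad
  refine le_trans ?_ (h.cost_decrease hgrad)
  have hstep : min αbar (β * δ) ≤ β ^ m k * αbar := by
    rcases hm : m k with _ | n
    · simp
    refine (min_le_right _ _).trans ?_
    rw [pow_succ', mul_assoc]
    refine mul_le_mul_of_nonneg_left ?_ hβ.1.le
    -- Were the last rejected trial step below `δ`, it would pass the test, against the minimality
    -- of `m k`.
    by_contra! hlt
    have hpos : 0 < β ^ n * αbar := mul_pos (pow_pos hβ.1 n) hα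
    have hdir : ξ k = N.newtonDir wbar y := by
      have := h.direction k hgrad
      rw [hk] at this
      exact (N.isDirection_iff_eq hyi _).1 this
    have hn : N.ArmijoTest wbar σ (x k) (ξ k) (β ^ n * αbar) := by
      rw [hdir, hk]
      refine hpab hy (hδb ?_) (hk ▸ h.mem_manifold k) ((N.isDirection_iff_eq hyi _).2 rfl) hpos
      rwa [Real.dist_eq, sub_zero, abs_of_pos hpos]
    have := (h.armijo k hgrad).2 hn
    omega
  rw [hk]
  have hσ0 := hσ.1
  have hβ0 := hβ.1
  gcongr

/-- The costs decrease and are bounded below, so their differences tend to zero; a noncritical `xs`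
would force a decrease of at least `κ` infinitely often. -/
theorem IsRun.grad_eq_zero (h : N.IsRun wbar αbar β σ ε x ξ m) (hα : 0 < αbar)
    (hβ : 0 < β ∧ β < 1) (hσ : 0 < σ ∧ σ < 1) (hε : 0 ≤ ε)
    (hnever : ε = 0 ∨ ∀ k, ε < ‖N.grad wbar (x k)‖) {xs : LFState J} (hxs : xs ∈ N.manifold)
    (hr : N.RowsIndependent xs) (hcl : MapClusterPt xs atTop x) : N.grad wbar xs = 0 := by
  by_contra hg
  have hanti := h.antitone_cost hα hβ.1 hσ.1 hε
  have hlim := tendsto_atTop_ciInf hanti ⟨0, by rintro _ ⟨k, rfl⟩; exact cost_nonneg _ _⟩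
  have hdiff : Tendsto (fun k => cost wbar (x k) - cost wbar (x (k + 1))) atTop (𝓝 0) := by
    simpa using hlim.sub (hlim.comp (tendsto_add_atTop_nat 1))
  obtain ⟨κ, hκ, hev⟩ := h.exists_eventually_decrease hα hβ hσ hxs hr (N.cost_pos hg)
  have hlt : ∀ᶠ k in atTop, cost wbar (x k) - cost wbar (x (k + 1)) < κ := hdiff (gt_mem_nhds hκ)
  have hrun : ∀ k, ε < ‖N.grad wbar (x k)‖ := by
    rcases hnever with rfl | hnever
    -- If the method stops with `ε = 0`, the sequence is eventually constant, and its only cluster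
    -- point is the critical point where it stopped.
    · by_contra! hk
      obtain ⟨k, hk⟩ := hk
      have hconst : ∀ n, x (k + n) = x k := by
        intro n
        induction n with
        | zero => rfl
        | succ n ih => rw [← add_assoc, h.halt (k + n) (by rwa [ih]), ih]
      have hx : Tendsto x atTop (𝓝 (x k)) := by
        refine tendsto_const_nhds.congr' ?_
        filter_upwards [eventually_ge_atTop k] with n hn
        rw [← hconst (n - k), Nat.add_sub_cancel' hn]
      have : xs = x k := by
        by_contra hne
        obtain ⟨u, v, hu, hv, huv⟩ := t2_separation_nhds hne
        obtain ⟨n, hn, hn'⟩ := ((hcl.frequently hu).and_eventually (hx hv)).exists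
        exact huv.le_bot ⟨hn, hn'⟩
      exact hg (norm_le_zero_iff.1 (this ▸ hk))
    · exact hnever
  obtain ⟨k, hk, hk'⟩ := ((hcl.frequently hev).and_eventually hlt).exists
  exact (hk k rfl (hrun k)).not_gt hk'

end Run

end RadialNetwork

/-! ### Local convergence near a nondegenerate critical point -/

namespace RadialNetwork

variable {J : ℕ} (N : RadialNetwork J)

/-- The full step along the direction. -/
def newtonPt (wbar : Injections J) (x : LFState J) : LFState J :=
  N.retr x (N.newtonDir wbar x)

section Local

variable {N} {wbar : Injections J} {xs : LFState J}

theorem hasFDerivAt_system (x : LFState J) :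
    HasFDerivAt (fun y => (N.F y, injectionsL J y - wbar)) (N.systemMap x) x :=
  ((N.contDiff_F.differentiable (by simp) x).hasFDerivAt).prodMk
    ((injectionsL J).hasFDerivAt.sub_const wbar)

theorem injections_sub_eq_zero (hc : cost wbar xs = 0) : injectionsL J xs - wbar = 0 := by
  simpa [cost_eq] using hc

theorem newtonDir_eq_zero (hc : cost wbar xs = 0) : N.newtonDir wbar xs = 0 := by
  rw [newtonDir, ← neg_sub, injections_sub_eq_zero hc, neg_zero]
  exact map_zero _

/-- Newton's method for the square system `F x = 0`, `w = wbar`. -/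
theorem isLittleO_add_newtonDir (hxs : xs ∈ N.manifold) (hi : (N.systemMap xs).IsInvertible)
    (hc : cost wbar xs = 0) :
    (fun x => x + N.newtonDir wbar x - xs) =o[𝓝[N.manifold] xs] fun x => x - xs := by
  have h1 : (fun x => (N.F x, injectionsL J x - wbar) - (N.F xs, injectionsL J xs - wbar) -
      N.systemMap xs (x - xs)) =o[𝓝[N.manifold] xs] fun x => x - xs :=
    (hasFDerivAt_system xs).isLittleO.mono nhdsWithin_le_nhds
  have h2 : (fun x => (N.systemMap x - N.systemMap xs) (x - xs)) =o[𝓝[N.manifold] xs]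
      fun x => x - xs := by
    rw [Asymptotics.isLittleO_iff]
    intro c hc
    have : ∀ᶠ x in 𝓝 xs, ‖N.systemMap x - N.systemMap xs‖ < c := by
      have hcont : Continuous fun x => ‖N.systemMap x - N.systemMap xs‖ :=
        (N.continuous_systemMap.sub continuous_const).norm
      exact hcont.tendsto xs (gt_mem_nhds (by simpa using hc))
    filter_upwards [nhdsWithin_le_nhds this] with x hx
    exact ((N.systemMap x - N.systemMap xs).le_opNorm _).trans
      (mul_le_mul_of_nonneg_right hx.le (norm_nonneg _))
  have h3 : (fun x => x + N.newtonDir wbar x - xs) =O[𝓝[N.manifold] xs] fun x =>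
      (N.systemMap x - N.systemMap xs) (x - xs) -
        ((N.F x, injectionsL J x - wbar) - (N.F xs, injectionsL J xs - wbar) -
          N.systemMap xs (x - xs)) := by
    have hb : ∀ᶠ x in 𝓝 xs, ‖(N.systemMap x).inverse‖ < ‖(N.systemMap xs).inverse‖ + 1 :=
      (N.continuousAt_inverse_systemMap hi).norm (gt_mem_nhds (lt_add_one _))
    refine Asymptotics.IsBigO.of_bound (‖(N.systemMap xs).inverse‖ + 1) ?_
    filter_upwards [nhdsWithin_le_nhds hb, nhdsWithin_le_nhds (N.eventually_isInvertible hi),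
      self_mem_nhdsWithin] with x hx hxi hxM
    have hdir := (N.isDirection_iff wbar x _).1 ((N.isDirection_iff_eq hxi _).2 rfl)
    have heq : x + N.newtonDir wbar x - xs = (N.systemMap x).inverse
        ((N.systemMap x - N.systemMap xs) (x - xs) -
        ((N.F x, injectionsL J x - wbar) - (N.F xs, injectionsL J xs - wbar) -
          N.systemMap xs (x - xs))) := by
      -- Write `G = (F, w - w̄)` and `A = DG`. On the manifold the direction `ξ` solves `A(x) ξ =
      -- -G(x)`, and `G(xs) = 0`, as in the usual Newton error identity.
      have h4 : (N.systemMap x - N.systemMap xs) (x - xs) -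
        ((N.F x, injectionsL J x - wbar) - (N.F xs, injectionsL J xs - wbar) -
          N.systemMap xs (x - xs)) = N.systemMap x (x + N.newtonDir wbar x - xs) := by
        rw [add_sub_right_comm, map_add, hdir, hxM.1, hxs.1, injections_sub_eq_zero hc,
          sub_apply, Prod.mk_zero_zero, sub_zero]
        have h5 : ((0 : EuclideanSpace ℝ (Fin 4 × Fin J)), wbar - injectionsL J x) =
            -(0, injectionsL J x - wbar) := by simp
        rw [h5]
        abel
      rw [h4, ← ContinuousLinearMap.comp_apply, hxi.inverse_comp_self,
        ContinuousLinearMap.id_apply]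
    rw [heq]
    exact (ContinuousLinearMap.le_opNorm _ _).trans
      (mul_le_mul_of_nonneg_right hx.le (norm_nonneg _))
  exact h3.trans_isLittleO (h2.sub h1)

theorem tendsto_add_newtonDir (hi : (N.systemMap xs).IsInvertible) (hc : cost wbar xs = 0) :
    Tendsto (fun x => x + N.newtonDir wbar x) (𝓝[N.manifold] xs) (𝓝 xs) := by
  have : Tendsto (fun x => x + N.newtonDir wbar x) (𝓝 xs) (𝓝 (xs + N.newtonDir wbar xs)) :=
    tendsto_id.add (N.continuousAt_newtonDir wbar hi)
  rw [newtonDir_eq_zero hc, add_zero] at this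
  exact this.mono_left nhdsWithin_le_nhds

/-- The sweep fixes `xs` and is differentiable there, so it enlarges the error of the Newton step by
at most a constant factor. -/
theorem isLittleO_newtonPt (hxs : xs ∈ N.manifold) (hi : (N.systemMap xs).IsInvertible)
    (hc : cost wbar xs = 0) :
    (fun x => N.newtonPt wbar x - xs) =o[𝓝[N.manifold] xs] fun x => x - xs := by
  have hS : DifferentiableAt ℝ N.sweep xs :=
    (N.contDiffAt_sweep (N.mem_sweepDomain_of_mem hxs)).differentiableAt (by simp)
  have h1 := hS.isBigO_sub.comp_tendsto (tendsto_add_newtonDir hi hc)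
  rw [N.sweep_of_mem hxs] at h1
  exact h1.trans_isLittleO (isLittleO_add_newtonDir hxs hi hc)

/-- Near a nondegenerate zero of the mismatch, the mismatch controls the distance. -/
theorem isBigO_sub_injections (hxs : xs ∈ N.manifold) (hi : (N.systemMap xs).IsInvertible)
    (hc : cost wbar xs = 0) :
    (fun x => x - xs) =O[𝓝[N.manifold] xs] fun x => injectionsL J x - wbar := by
  obtain ⟨e, he⟩ := hi
  have hind : Topology.IsInducing (N.systemMap xs) := by
    rw [← he]
    exact e.toHomeomorph.isInducing
  -- The derivative at `xs` is invertible, so `G(x) - G(xs)` is of the order of `x - xs`; on the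
  -- manifold only its `w` block survives.
  have h1 := ((hasFDerivAt_system (wbar := wbar) xs).isTheta_sub hind).2.mono
    (nhdsWithin_le_nhds (s := N.manifold))
  refine h1.trans (Asymptotics.IsBigO.of_bound 1 ?_)
  filter_upwards [self_mem_nhdsWithin] with x hxM
  rw [hxM.1, hxs.1, injections_sub_eq_zero hc]
  simp

/-- The new mismatch is `o(‖x - xs‖)`, and `‖x - xs‖` is bounded by a multiple of the old mismatch.
-/
theorem eventually_cost_newtonPt_le (hxs : xs ∈ N.manifold) (hi : (N.systemMap xs).IsInvertible)
    (hc : cost wbar xs = 0) {c : ℝ} (hcpos : 0 < c) :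
    ∀ᶠ x in 𝓝[N.manifold] xs, cost wbar (N.newtonPt wbar x) ≤ c * cost wbar x := by
  have h1 : (fun x => injectionsL J (N.newtonPt wbar x - xs)) =o[𝓝[N.manifold] xs]
      fun x => injectionsL J x - wbar :=
    ((injectionsL J).isBigO_comp _ _).trans_isLittleO
      ((isLittleO_newtonPt hxs hi hc).trans_isBigO (isBigO_sub_injections hxs hi hc))
  filter_upwards [h1.bound (Real.sqrt_pos.2 hcpos)] with x hx
  rw [map_sub, sub_eq_zero.1 (injections_sub_eq_zero hc)] at hx
  have h2 := pow_le_pow_left₀ (norm_nonneg _) hx 2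
  rwa [mul_pow, Real.sq_sqrt hcpos.le] at h2

theorem eventually_mem_manifold (hxs : xs ∈ N.manifold) :
    ∀ᶠ x in 𝓝 xs, N.F x = 0 → x ∈ N.manifold := by
  have h1 : ∀ᶠ x : LFState J in 𝓝 xs, ∀ j, N.upV (fun i => x (3, i)) j ≠ 0 :=
    eventually_all.2 fun j => ContinuousAt.eventually_ne
      (N.contDiffAt_upV (n := 0) fun i _ => by fun_prop).continuousAt (hxs.2 j)
  filter_upwards [h1] with x hx h0 using ⟨h0, hx⟩

/-- A ball around a nondegenerate critical point in which full steps contract. -/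
theorem exists_radius (hxs : xs ∈ N.manifold) (hi : (N.systemMap xs).IsInvertible)
    (hc : cost wbar xs = 0) {p : LFState J → Prop} (hp : ∀ᶠ x in 𝓝[N.manifold] xs, p x) :
    ∃ r > 0, (∀ x, ‖x - xs‖ < r → N.F x = 0 → x ∈ N.manifold) ∧
      ∀ x ∈ N.manifold, ‖x - xs‖ < r → p x ∧
        (N.systemMap x).IsInvertible ∧ N.newtonDir wbar x ∈ N.retrDomain x ∧
        ‖N.newtonPt wbar x - xs‖ ≤ 1 / 2 * ‖x - xs‖ ∧ (cost wbar x = 0 → x = xs) := by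
  obtain ⟨C, hC⟩ := (isBigO_sub_injections hxs hi hc).bound
  have hdom := (tendsto_add_newtonDir hi hc).eventually
    (N.isOpen_sweepDomain.mem_nhds (N.mem_sweepDomain_of_mem hxs))
  have hinv : ∀ᶠ x in 𝓝[N.manifold] xs, (N.systemMap x).IsInvertible :=
    nhdsWithin_le_nhds (N.eventually_isInvertible hi)
  have hev := hp.and (hinv.and
    (hdom.and (((isLittleO_newtonPt hxs hi hc).bound (by norm_num : (0 : ℝ) < 1 / 2)).and hC)))
  obtain ⟨r₁, hr₁, h₁⟩ := Metric.eventually_nhds_iff.1 (eventually_mem_manifold hxs)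
  obtain ⟨r₂, hr₂, h₂⟩ := Metric.eventually_nhds_iff.1 (eventually_nhdsWithin_iff.1 hev)
  refine ⟨min r₁ r₂, lt_min hr₁ hr₂, fun x hx => h₁ ?_, fun x hxM hx => ?_⟩
  · rw [dist_eq_norm]
    exact hx.trans_le (min_le_left _ _)
  · obtain ⟨hpx, hix, hdx, hhx, hCx⟩ :=
      h₂ (by rw [dist_eq_norm]; exact hx.trans_le (min_le_right _ _)) hxM
    refine ⟨hpx, hix, hdx, hhx, fun h0 => ?_⟩
    rw [injections_sub_eq_zero h0, norm_zero, mul_zero] at hCx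
    exact sub_eq_zero.1 (norm_le_zero_iff.1 hCx)

theorem IsUnitStepRun.mem_manifold {x : ℕ → LFState J} (h : N.IsUnitStepRun wbar x) (k : ℕ) :
    x k ∈ N.manifold := by
  cases k with
  | zero => exact h.1
  | succ k =>
    obtain ⟨ξ, -, hξ, hx⟩ := h.2 k
    rw [hx]
    exact N.retr_mem hξ

theorem iterate_newtonPt_mem {r : ℝ} (hM : ∀ x ∈ N.manifold, ‖x - xs‖ < r →
      N.newtonDir wbar x ∈ N.retrDomain x ∧ ‖N.newtonPt wbar x - xs‖ ≤ 1 / 2 * ‖x - xs‖)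
    {x₀ : LFState J} (h0 : x₀ ∈ N.manifold) (hr : ‖x₀ - xs‖ < r) (k : ℕ) :
    (N.newtonPt wbar)^[k] x₀ ∈ N.manifold ∧ ‖(N.newtonPt wbar)^[k] x₀ - xs‖ < r := by
  induction k with
  | zero => exact ⟨h0, hr⟩
  | succ k ih =>
    rw [Function.iterate_succ_apply']
    obtain ⟨h1, h2⟩ := hM _ ih.1 ih.2
    exact ⟨N.retr_mem h1, by linarith [ih.2, norm_nonneg ((N.newtonPt wbar)^[k] x₀ - xs)]⟩

theorem unitStep_superlinear (hxs : xs ∈ N.manifold) (hi : (N.systemMap xs).IsInvertible)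
    (hc : cost wbar xs = 0) :
    ∃ U ∈ 𝓝 xs, ∀ x₀ ∈ U, N.F x₀ = 0 →
      (∃ x : ℕ → LFState J, x 0 = x₀ ∧ N.IsUnitStepRun wbar x) ∧
      (∀ x : ℕ → LFState J, x 0 = x₀ → N.IsUnitStepRun wbar x → ConvergesSuperlinearly x xs) := by
  obtain ⟨r, hr, hrM, hgood⟩ := exists_radius hxs hi hc (p := fun _ => True) (by simp)
  refine ⟨Metric.ball xs r, Metric.ball_mem_nhds xs hr, fun x₀ hx₀ hF => ?_⟩
  rw [mem_ball_iff_norm] at hx₀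
  have hx₀M := hrM x₀ hx₀ hF
  constructor
  · have hit := iterate_newtonPt_mem (wbar := wbar)
      (fun x h1 h2 => ⟨(hgood x h1 h2).2.2.1, (hgood x h1 h2).2.2.2.1⟩) hx₀M hx₀
    refine ⟨fun k => (N.newtonPt wbar)^[k] x₀, rfl, hx₀M, fun k =>
      ⟨N.newtonDir wbar ((N.newtonPt wbar)^[k] x₀), ?_, ?_, ?_⟩⟩
    · exact (N.isDirection_iff_eq (hgood _ (hit k).1 (hit k).2).2.1 _).2 rfl
    · exact (hgood _ (hit k).1 (hit k).2).2.2.1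
    · exact Function.iterate_succ_apply' _ _ _
  · rintro x rfl hrun
    refine convergesSuperlinearly_of_step (isLittleO_newtonPt hxs hi hc)
      (fun y h1 h2 => (hgood y h1 h2).2.2.2.1) hrun.mem_manifold hx₀ fun k hk => ?_
    obtain ⟨ξ, hξ, -, hx⟩ := hrun.2 k
    rw [hx, (N.isDirection_iff_eq (hgood _ (hrun.mem_manifold k) hk).2.1 _).1 hξ, newtonPt]

/-- The Armijo test for the full step asks for a decrease of `2σ f(x)`. Near `xs` the full step
leaves at most `(1 - 2σ) f(x)`, so exponent `0` is always accepted and the method makes pure Newton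
steps. -/
theorem armijo_superlinear (hxs : xs ∈ N.manifold) (hi : (N.systemMap xs).IsInvertible)
    (hc : cost wbar xs = 0) (β : ℝ) {σ : ℝ} (hσ : σ < 1 / 2) :
    ∃ U ∈ 𝓝 xs, ∀ x₀ ∈ U, N.F x₀ = 0 →
      (∃ (x ξ : ℕ → LFState J) (m : ℕ → ℕ), x 0 = x₀ ∧ N.IsRun wbar 1 β σ 0 x ξ m) ∧
      (∀ (x ξ : ℕ → LFState J) (m : ℕ → ℕ), x 0 = x₀ → N.IsRun wbar 1 β σ 0 x ξ m →
        ConvergesSuperlinearly x xs) := by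
  obtain ⟨r, hr, hrM, hgood⟩ := exists_radius hxs hi hc
    (eventually_cost_newtonPt_le hxs hi hc (by linarith : 0 < 1 - 2 * σ))
  have htest : ∀ x ∈ N.manifold, ‖x - xs‖ < r →
      N.ArmijoTest wbar σ x (N.newtonDir wbar x) (β ^ 0 * 1) := by
    intro x hx hxr
    obtain ⟨h1, h2, h3, -⟩ := hgood x hx hxr
    rw [pow_zero, one_mul]
    refine ⟨by rwa [one_smul], ?_⟩
    rw [one_smul, ((N.isDirection_iff_eq h2 _).2 rfl).inner_grad]
    rw [newtonPt] at h1
    linarith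
  -- In the ball the only critical point is `xs`, a fixed point of the full step, so halting agrees
  -- with the Newton recursion.
  have hfix : ∀ x ∈ N.manifold, ‖x - xs‖ < r → ‖N.grad wbar x‖ ≤ 0 → N.newtonPt wbar x = x := by
    intro x hx hxr hg
    obtain ⟨-, h2, -, h4, h5⟩ := hgood x hx hxr
    have h6 := h5 (N.cost_eq_zero_of_grad_eq_zero h2 (norm_le_zero_iff.1 hg))
    rw [h6, sub_self, norm_zero, mul_zero] at h4
    rw [h6]
    exact sub_eq_zero.1 (norm_le_zero_iff.1 h4)
  refine ⟨Metric.ball xs r, Metric.ball_mem_nhds xs hr, fun x₀ hx₀ hF => ?_⟩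
  rw [mem_ball_iff_norm] at hx₀
  have hx₀M := hrM x₀ hx₀ hF
  constructor
  · have hit := iterate_newtonPt_mem (wbar := wbar)
      (fun x h1 h2 => ⟨(hgood x h1 h2).2.2.1, (hgood x h1 h2).2.2.2.1⟩) hx₀M hx₀
    refine ⟨fun k => (N.newtonPt wbar)^[k] x₀,
      fun k => N.newtonDir wbar ((N.newtonPt wbar)^[k] x₀), fun _ => 0, rfl, hx₀M, ?_, ?_, ?_, ?_⟩
    · exact fun k _ => (N.isDirection_iff_eq (hgood _ (hit k).1 (hit k).2).2.1 _).2 rfl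
    · exact fun k _ => ⟨htest _ (hit k).1 (hit k).2, fun n _ => n.zero_le⟩
    · intro k _
      simp only [Function.iterate_succ_apply', pow_zero, one_mul, one_smul, newtonPt]
    · intro k hk
      simp only [Function.iterate_succ_apply']
      exact hfix _ (hit k).1 (hit k).2 hk
  · rintro x ξ m rfl hrun
    refine convergesSuperlinearly_of_step (isLittleO_newtonPt hxs hi hc)
      (fun y h1 h2 => (hgood y h1 h2).2.2.2.1) hrun.mem_manifold hx₀ fun k hk => ?_
    have hxk := hrun.mem_manifold k
    rcases lt_or_ge 0 ‖N.grad wbar (x k)‖ with hg | hg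
    · have hξ := (N.isDirection_iff_eq (hgood _ hxk hk).2.1 _).1 (hrun.direction k hg)
      have hm : m k = 0 := by
        have h1 := htest _ hxk hk
        rw [← hξ] at h1
        exact Nat.le_zero.1 ((hrun.armijo k hg).2 h1)
      rw [hrun.step k hg, hm, pow_zero, one_mul, one_smul, hξ, newtonPt]
    · rw [hrun.halt k hg, hfix _ hxk hk hg]

end Local

end RadialNetwork

end

/-! ### Assembly of the proposition -/

theorem proposition1 {J : ℕ} (N : RadialNetwork J) (wbar : Injections J)
    (αbar β σ : ℝ) (hα : 0 < αbar) (hβ : 0 < β ∧ β < 1) (hσ : 0 < σ ∧ σ < 1) :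
    -- the constraints are regular and the forward sweep is a retraction
    (∀ x ∈ N.manifold, Function.Surjective (fderiv ℝ N.F x) ∧
      IsRetractionAt N.F x (N.retrDomain x) (N.retr x)) ∧
    (∀ x ∈ N.manifold, ∀ ξ ∈ N.retrDomain x, N.retr x ξ ∈ N.manifold) ∧
    -- the direction solves an approximate Newton equation, whose solution is unique
    (∀ x ∈ N.manifold, ∀ ξ, N.IsDirection wbar x ξ →
      IsApproxNewtonDirection N.F (RadialNetwork.cost wbar)
        (hessError N.F (RadialNetwork.cost wbar) x) x ξ) ∧
    (∀ x ∈ N.manifold, N.RowsIndependent x →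
      (∃! ξ, N.IsDirection wbar x ξ) ∧
      (∃! ξ, IsApproxNewtonDirection N.F (RadialNetwork.cost wbar)
        (hessError N.F (RadialNetwork.cost wbar) x) x ξ)) ∧
    -- the Hessian error is bounded by the gradient
    (∀ K : Set (LFState J), IsCompact K → K ⊆ {x ∈ N.manifold | N.RowsIndependent x} →
      ∃ γ : ℝ, ∀ x ∈ K,
        ‖hessError N.F (RadialNetwork.cost wbar) x‖ ≤ γ * ‖N.grad wbar x‖) ∧
    -- the direction is a descent direction and the Armijo search is successful
    (∀ x ∈ N.manifold, N.grad wbar x ≠ 0 → ∀ ξ, N.IsDirection wbar x ξ →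
      inner ℝ (N.grad wbar x) ξ < 0 ∧
      ∃ n : ℕ, N.ArmijoTest wbar σ x ξ (β ^ n * αbar)) ∧
    -- every iteration gives descent
    (∀ ε : ℝ, 0 ≤ ε → ∀ (x ξ : ℕ → LFState J) (m : ℕ → ℕ),
      N.IsRun wbar αbar β σ ε x ξ m →
      ∀ k, x k ∈ N.manifold ∧ (ε < ‖N.grad wbar (x k)‖ →
        RadialNetwork.cost wbar (x (k + 1)) < RadialNetwork.cost wbar (x k))) ∧
    -- accumulation points are critical
    (∀ ε : ℝ, 0 ≤ ε → ∀ (x ξ : ℕ → LFState J) (m : ℕ → ℕ),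
      N.IsRun wbar αbar β σ ε x ξ m → (ε = 0 ∨ ∀ k, ε < ‖N.grad wbar (x k)‖) →
      ∀ xs ∈ N.manifold, N.RowsIndependent xs → MapClusterPt xs atTop x →
        N.grad wbar xs = 0) ∧
    -- local superlinear convergence, for unit steps and for Armijo steps with initial step 1
    (∀ xs ∈ N.manifold, N.grad wbar xs = 0 → N.RowsIndependent xs →
      (∃ U ∈ 𝓝 xs, ∀ x₀ ∈ U, N.F x₀ = 0 →
        (∃ x : ℕ → LFState J, x 0 = x₀ ∧ N.IsUnitStepRun wbar x) ∧
        (∀ x : ℕ → LFState J, x 0 = x₀ → N.IsUnitStepRun wbar x →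
          ConvergesSuperlinearly x xs)) ∧
      (αbar = 1 → σ < 1 / 2 → ∃ U ∈ 𝓝 xs, ∀ x₀ ∈ U, N.F x₀ = 0 →
        (∃ (x ξ : ℕ → LFState J) (m : ℕ → ℕ), x 0 = x₀ ∧ N.IsRun wbar αbar β σ 0 x ξ m) ∧
        (∀ (x ξ : ℕ → LFState J) (m : ℕ → ℕ), x 0 = x₀ → N.IsRun wbar αbar β σ 0 x ξ m →
          ConvergesSuperlinearly x xs))) := by
  refine ⟨fun x hx => ⟨N.surjective_fderiv_F hx.2, N.isRetractionAt hx⟩,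
    fun x _ ξ hξ => N.retr_mem hξ,
    fun x hx ξ hξ => hξ.isApproxNewtonDirection hx,
    fun x hx hr => ⟨N.existsUnique_isDirection wbar hr,
      N.existsUnique_isApproxNewtonDirection wbar hx hr⟩,
    fun K hK hKM => N.exists_norm_hessError_le wbar hK hKM, ?_, ?_, ?_, ?_⟩
  · intro x hx hg ξ hξ
    have hc := N.cost_pos hg
    refine ⟨?_, hξ.exists_armijoTest hα hβ hσ.2 hx hc⟩
    rw [hξ.inner_grad]
    linarith
  · exact fun ε hε x ξ m hrun k =>
      ⟨hrun.mem_manifold k, fun hk => hrun.cost_lt hα hβ.1 hσ.1 hε hk⟩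
  · exact fun ε hε x ξ m hrun hnever xs hxs hr hcl =>
      hrun.grad_eq_zero hα hβ hσ hε hnever hxs hr hcl
  · intro xs hxs hg hr
    have hi := hr.isInvertible
    -- A nondegenerate critical point is a root of the square system, which is what makes the Newton
    -- analysis applicable.
    have hc := N.cost_eq_zero_of_grad_eq_zero hi hg
    refine ⟨RadialNetwork.unitStep_superlinear hxs hi hc, ?_⟩
    rintro rfl hσ'
    exact RadialNetwork.armijo_superlinear hxs hi hc β hσ'
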